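/- Let $N\ge 2$ be an integer, let $\mathbb T=\{z\in\mathbb C:|z|=1\}$ with normalized Haar measure $\mu$, and let $(H,U,\pi)$ be a normal wavelet representation of scale $N$. That is: $H$ is a complex Hilbert space, $U$ is a unitary operator on $H$, $\pi$ is a (unital $*$-)representation of $L^\infty(\mathbb T)$ on $H$ with $U\pi(f)U^{-1}=\pi(f(z^N))$ for all $f\in L^\infty(\mathbb T)$, and whenever $f_n\to f$ a.e. with $f_n,f\in L^\infty(\mathbb T)$ and $\sup_n\|f_n\|_\infty<\infty$, then $\pi(f_n)\to\pi(f)$ in the strong operator topology. Put $T=\pi(z)$. A vector $\varphi\in H$ is called an orthogonal scaling vector if there is a sequence $(V_n)_{n\in\mathbb Z}$ of closed subspaces of $H$ (a multiresolution analysis) such that $V_n\subset V_{n+1}$ and $U(V_n)=V_{n-1}$ for all $n$, $\overline{\bigcup_n V_n}=H$, $\bigcap_n V_n=\{0\}$, $\varphi\in V_0$, and $\{T^k\varphi: k\in\mathbb Z\}$ is an orthonormal basis of $V_0$. The correlation function $h_\varphi\in L^1(\mathbb T)$ of $\varphi$ is the function, unique up to a.e. equality, with $\langle\pi(f)\varphi,\varphi\rangle=\int_{\mathbb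 T} f\,h_\varphi\,d\mu$ for all $f\in L^\infty(\mathbb T)$. A function $m_0\in L^\infty(\mathbb T)$ is called degenerate if $|m_0|=1$ a.e. and there are a measurable $\xi:\mathbb T\to\mathbb T$ and a $\lambda\in\mathbb T$ with $m_0(z)\,\xi(z^N)=\lambda\,\xi(z)$ for a.e. $z\in\mathbb T$; otherwise it is non-degenerate. **Theorem.** A vector $\varphi\in H$ is an orthogonal scaling vector if and only if the following three conditions hold: 1. (Orthogonality) $h_\varphi=1$ a.e.; 2. (Scaling equation) there exists a non-degenerate $m_0\in L^\infty(\mathbb T)$ such that $U\varphi=\pi(m_0)\varphi$; 3. (Cyclicity) there is no orthogonal projection $p\neq I$ on $H$ that commutes with $U$ and with all $\pi(f)$, $f\in L^\infty(\mathbb T)$, and satisfies $p\varphi=\varphi$. -/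

import Mathlib

open MeasureTheory Filter Topology
open scoped ENNReal ComplexConjugate

noncomputable section

namespace Wavelet

/-- The Borel sigma-algebra on the unit circle `𝕋 = {z ∈ ℂ : |z| = 1}`. -/
instance instMeasurableSpaceCircle : MeasurableSpace Circle := borel Circle

instance instBorelSpaceCircle : BorelSpace Circle := ⟨rfl⟩

/-- The normalized Haar measure on the unit circle. -/
def haar : Measure Circle := Measure.haarMeasure ⊤

instance instIsHaarMeasureHaar : Measure.IsHaarMeasure haar :=
  inferInstanceAs (Measure.IsHaarMeasure (Measure.haarMeasure ⊤))

instance instIsProbabilityMeasureHaar : IsProbabilityMeasure haar :=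
  ⟨Measure.haarMeasure_self⟩

/-- `L^∞(𝕋)`: essentially bounded measurable complex functions modulo a.e. equality. -/
abbrev Linf : Type := Lp ℂ ∞ haar

lemma pow_surjective (N : ℕ) [NeZero N] : Function.Surjective (fun z : Circle => z ^ N) := by
  intro z
  refine ⟨Circle.exp (Complex.arg z / N), ?_⟩
  have h : (N : ℝ) * (Complex.arg z / N) = Complex.arg z := by
    have : (N : ℝ) ≠ 0 := Nat.cast_ne_zero.mpr (NeZero.ne N)
    field_simp
  change Circle.exp (Complex.arg z / N) ^ N = z
  rw [← Circle.exp_natCast_mul, h, Circle.exp_arg]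

/-- `z ↦ z ^ N` preserves Haar measure on the circle (`N ≠ 0`). -/
lemma measurePreserving_pow (N : ℕ) [NeZero N] :
    MeasurePreserving (fun z : Circle => z ^ N) haar haar :=
  MonoidHom.measurePreserving (μ := haar) (ν := haar) (f := (powMonoidHom N : Circle →* Circle))
    (continuous_pow N) (pow_surjective N) rfl

/-- The map `f ↦ f(z ^ N)` on `L^∞(𝕋)`. -/
def dilate (N : ℕ) [NeZero N] (f : Linf) : Linf :=
  Lp.compMeasurePreserving (fun z : Circle => z ^ N) (measurePreserving_pow N) f

/-- The constant function `1` as an element of `L^∞(𝕋)`. -/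
def Linf.one : Linf := Lp.const ∞ haar (1 : ℂ)

lemma memLp_coe : MemLp (fun z : Circle => (z : ℂ)) ∞ haar := by
  have hc : Continuous (fun z : Circle => (z : ℂ)) := by fun_prop
  exact memLp_top_of_bound hc.aestronglyMeasurable 1
    (Eventually.of_forall fun z => (Circle.norm_coe z).le)

/-- The identity function `z ↦ z` as an element of `L^∞(𝕋)`. -/
def Linf.z : Linf := memLp_coe.toLp _

/-- The pointwise product of two elements of `L^∞(𝕋)`. -/
def Linf.mul (f g : Linf) : Linf := f • g

lemma Linf.coeFn_mul (f g : Linf) : (Linf.mul f g : Circle → ℂ) =ᵐ[haar] fun z => f z * g z :=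
  Lp.coeFn_lpSMul f g

lemma Linf.coeFn_one : (Linf.one : Circle → ℂ) =ᵐ[haar] fun _ => 1 :=
  Lp.coeFn_const (p := ∞) (μ := haar) (1 : ℂ)

lemma Linf.coeFn_z : (Linf.z : Circle → ℂ) =ᵐ[haar] fun z => (z : ℂ) :=
  MemLp.coeFn_toLp memLp_coe

lemma Linf.star_z_mul_z : Linf.mul (star Linf.z) Linf.z = Linf.one := by
  refine Lp.ext ?_
  filter_upwards [Linf.coeFn_mul (star Linf.z) Linf.z, Linf.coeFn_one, Linf.coeFn_z,
    Lp.coeFn_star Linf.z] with w h1 h2 h3 h4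
  rw [h1, h2, h4, Pi.star_apply, h3]
  simp [← Complex.normSq_eq_conj_mul_self]

lemma Linf.z_mul_star_z : Linf.mul Linf.z (star Linf.z) = Linf.one := by
  refine Lp.ext ?_
  filter_upwards [Linf.coeFn_mul Linf.z (star Linf.z), Linf.coeFn_one, Linf.coeFn_z,
    Lp.coeFn_star Linf.z] with w h1 h2 h3 h4
  rw [h1, h2, h4, Pi.star_apply, h3]
  simp [Complex.mul_conj]

/-- A wavelet representation of scale `N` on the Hilbert space `H`: a unitary `U` and a (unital,
`*`-preserving) representation `π` of the algebra `L^∞(𝕋)` on `H` such that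
`U π(f) U⁻¹ = π(f(z ^ N))`. -/
structure WaveletRep (N : ℕ) [N.AtLeastTwo] (H : Type*) [NormedAddCommGroup H]
    [InnerProductSpace ℂ H] [CompleteSpace H] where
  U : unitary (H →L[ℂ] H)
  π : Linf →ₗ[ℂ] (H →L[ℂ] H)
  map_one : π Linf.one = 1
  map_mul : ∀ f g : Linf, π (Linf.mul f g) = π f * π g
  map_star : ∀ f : Linf, π (star f) = star (π f)
  covariance : ∀ f : Linf,
    (U : H →L[ℂ] H) * π f * ((U⁻¹ : unitary (H →L[ℂ] H)) : H →L[ℂ] H) = π (dilate N f)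

namespace WaveletRep

variable {N : ℕ} [N.AtLeastTwo] {H : Type*} [NormedAddCommGroup H] [InnerProductSpace ℂ H]
  [CompleteSpace H]

/-- Normality: if `f_n → f` a.e. and `‖f_n‖_∞ ≤ M` for all `n`, then `π(f_n) → π(f)` in the strong
operator topology. -/
def IsNormal (ρ : WaveletRep N H) : Prop :=
  ∀ (f : ℕ → Linf) (g : Linf) (M : ℝ), (∀ n, ‖f n‖ ≤ M) →
    (∀ᵐ z ∂haar, Tendsto (fun n => f n z) atTop (𝓝 (g z))) →
      ∀ x : H, Tendsto (fun n => ρ.π (f n) x) atTop (𝓝 (ρ.π g x))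

/-- The translation `T = π(z)`, a unitary operator. -/
def T (ρ : WaveletRep N H) : unitary (H →L[ℂ] H) :=
  ⟨ρ.π Linf.z, by
    rw [Unitary.mem_iff, ← ρ.map_star, ← ρ.map_mul, ← ρ.map_mul, Linf.star_z_mul_z,
      Linf.z_mul_star_z, ρ.map_one]
    exact ⟨rfl, rfl⟩⟩

/-- `(V_n)_{n ∈ ℤ}` is a multiresolution analysis with `φ ∈ V_0` as its vector whose integer
translates form an orthonormal basis of `V_0`. -/
structure IsMRAWith (ρ : WaveletRep N H) (V : ℤ → Submodule ℂ H) (φ : H) : Prop where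
  isClosed : ∀ n, IsClosed (V n : Set H)
  le_succ : ∀ n, V n ≤ V (n + 1)
  closure_iUnion : closure (⋃ n, (V n : Set H)) = Set.univ
  iInf_eq_bot : ⨅ n, V n = ⊥
  map_U : ∀ n, (V n).map ((ρ.U : H →L[ℂ] H) : H →ₗ[ℂ] H) = V (n - 1)
  mem_zero : φ ∈ V 0
  orthonormal : Orthonormal ℂ (fun k : ℤ => ((ρ.T ^ k : unitary (H →L[ℂ] H)) : H →L[ℂ] H) φ)
  closure_span : (Submodule.span ℂ (Set.range
    fun k : ℤ => ((ρ.T ^ k : unitary (H →L[ℂ] H)) : H →L[ℂ] H) φ)).topologicalClosure = V 0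

/-- `φ` is an orthogonal scaling vector: it generates some multiresolution analysis. -/
def IsOrthogonalScalingVector (ρ : WaveletRep N H) (φ : H) : Prop :=
  ∃ V : ℤ → Submodule ℂ H, ρ.IsMRAWith V φ

/-- `h ∈ L¹(𝕋)` is the correlation function of `v₁` and `v₂` (it is determined up to a.e.
equality): `⟨π(f) v₁, v₂⟩ = ∫ f h dμ` for all `f ∈ L^∞(𝕋)`. Here `⟨x, y⟩`, linear in `x`, is
`inner ℂ y x`, as `inner` is linear in its second argument. -/
def IsCorrelationFunction (ρ : WaveletRep N H) (v₁ v₂ : H) (h : Circle → ℂ) : Prop :=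
  Integrable h haar ∧ ∀ f : Linf, inner ℂ v₂ (ρ.π f v₁) = ∫ z, f z * h z ∂haar

lemma IsCorrelationFunction.ae_eq {ρ : WaveletRep N H} {v₁ v₂ : H} {h h' : Circle → ℂ}
    (hh : ρ.IsCorrelationFunction v₁ v₂ h) (hh' : ρ.IsCorrelationFunction v₁ v₂ h') :
    h =ᵐ[haar] h' := by
  refine Integrable.ae_eq_of_forall_setIntegral_eq h h' hh.1 hh'.1 fun s hs _ => ?_
  have key : ∀ k : Circle → ℂ, ∫ z in s, k z ∂haar =
      ∫ z, (indicatorConstLp ∞ hs (measure_ne_top haar s) (1 : ℂ) : Linf) z * k z ∂haar := by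
    intro k
    rw [← integral_indicator hs]
    refine integral_congr_ae ?_
    filter_upwards [indicatorConstLp_coeFn (p := ∞) (hs := hs) (hμs := measure_ne_top haar s)
      (c := (1 : ℂ))] with z hz
    rw [hz]
    by_cases hzs : z ∈ s <;> simp [hzs]
  rw [key, key, ← hh.2, ← hh'.2]

/-- The commutant of the set of operators `{U} ∪ {π(f) : f ∈ L^∞(𝕋)}`. -/
def commutant (ρ : WaveletRep N H) : Set (H →L[ℂ] H) :=
  Set.centralizer ({(ρ.U : H →L[ℂ] H)} ∪ Set.range ρ.π)

end WaveletRep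

/-- `m ∈ L^∞(𝕋)` is degenerate (for the scale `N`): `|m| = 1` a.e. and there are a measurable
`ξ : 𝕋 → 𝕋` and `c ∈ 𝕋` with `m(z) ξ(z ^ N) = c ξ(z)` for a.e. `z`. -/
def IsDegenerate (N : ℕ) (m : Linf) : Prop :=
  (∀ᵐ z ∂haar, ‖m z‖ = 1) ∧
    ∃ (ξ : Circle → Circle) (c : Circle), Measurable ξ ∧
      ∀ᵐ z ∂haar, m z * (ξ (z ^ N) : ℂ) = (c : ℂ) * (ξ z : ℂ)

end Wavelet

end

/-!
Write `P z = z ^ N`. If `⟨π(f) φ, φ⟩ = ∫ f` for all bounded `f`, then `f ↦ π(f) φ` extends to an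
isometry of `L²(𝕋)` onto the closed span of the translates of `φ` (`WaveletRep.synthesis`,
`WaveletRep.range_synthesis`). When `U φ = π(m) φ`, it intertwines `f ↦ m · (f ∘ P)` with `U`
(`WaveletRep.U_synthesis`). Since `U` is unitary, the weight `|m|²` makes `P` measure preserving
(`IsQuadrature`).

*From a multiresolution analysis.* Orthonormality of the translates is the correlation formula for
trigonometric polynomials; normality extends it to `L^∞`, as every bounded function is a bounded
almost everywhere limit of trigonometric polynomials. As `U φ ∈ V 0`, it corresponds to some
`m ∈ L²`, and the quadrature condition forces `|m|² ≤ N`, because the saturation of a set under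
`N`-th roots of unity is at most `N` times as large (`IsQuadrature.ae_le`). A solution of
`m · (ξ ∘ P) = c ξ` would give an eigenvector `π(ξ) φ` of `U` in `V 0`, hence a nonzero vector in
`⋂ V n`. A commuting projection fixing `φ` fixes every `V n`.

*To a multiresolution analysis.* Let `V n` be the vectors that `U ^ n` maps into the closed span of
the translates. Cyclicity, applied to the projection onto the closure of `⋃ V n`, gives density.
The main point is `⋂ V n = {0}`. A unit vector `v` in the intersection yields a backward orbit of
unit vectors `f n` in `L²` with `f n = m · (f (n + 1) ∘ P)`, where `f n` corresponds to `U⁻ⁿ v`.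
Then both `F n = |f n|²` and `F n = f (n + 1) * conj (f n)` satisfy `F n = |m|² · (F (n + 1) ∘ P)`.
Such sequences consist of one constant (`ae_eq_integral_of_backwardOrbit`): testing `F n` against
`k` is testing `F 0` against `k(z ^ (N ^ n))`, and these test functions become independent of `F 0`
(`exists_norm_integral_pow_mul_sub_le`), so `F n` tends to its mean in `L¹`; but the weighted
composition is isometric on `L¹`, so `‖F n - F (n + 1)‖₁` does not depend on `n` and is zero. Hence
`|f 0| = |f 1| = 1`, `f 0` is a constant multiple of `f 1`, and `m · (f 1 ∘ P) = f 0` says that `m`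
is degenerate.
-/

noncomputable section

namespace Wavelet

/-! ### Trigonometric polynomials on the circle -/

/-- The monomial `z ↦ z ^ j` as a continuous function on the circle. -/
def monomial (j : ℤ) : C(Circle, ℂ) where
  toFun z := ((z ^ j : Circle) : ℂ)
  continuous_toFun := continuous_induced_dom.comp (continuous_zpow j)

@[simp]
lemma monomial_apply (j : ℤ) (z : Circle) : monomial j z = ((z ^ j : Circle) : ℂ) := rfl

/-- The space of trigonometric polynomials. -/
def trigPoly : Submodule ℂ C(Circle, ℂ) := Submodule.span ℂ (Set.range monomial)

lemma trigPoly_dense : trigPoly.topologicalClosure = ⊤ := by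
  let A : StarSubalgebra ℂ C(Circle, ℂ) :=
    { toSubalgebra := Algebra.adjoin ℂ (Set.range monomial)
      star_mem' := by
        change Algebra.adjoin ℂ (Set.range monomial) ≤
          star (Algebra.adjoin ℂ (Set.range monomial))
        refine Algebra.adjoin_le ?_
        rintro - ⟨n, rfl⟩
        refine Algebra.subset_adjoin ⟨-n, ContinuousMap.ext fun z => ?_⟩
        simp [← Circle.coe_inv_eq_conj] }
  have hA : Subalgebra.toSubmodule A.toSubalgebra = trigPoly := by
    refine Algebra.adjoin_eq_span_of_subset (R := ℂ) ?_
    refine Set.Subset.trans ?_ Submodule.subset_span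
    intro x hx
    refine Submonoid.closure_induction (fun _ => id) ⟨0, ?_⟩ ?_ hx
    · ext z; simp
    · rintro - - - - ⟨m, rfl⟩ ⟨n, rfl⟩
      exact ⟨m + n, by ext z; simp [zpow_add]⟩
  have hsep : A.SeparatesPoints := by
    intro x y hxy
    refine ⟨_, ⟨monomial 1, Algebra.subset_adjoin ⟨1, rfl⟩, rfl⟩, ?_⟩
    simpa [Circle.coe_inj] using hxy
  rw [← hA]
  exact congr_arg (Subalgebra.toSubmodule <| StarSubalgebra.toSubalgebra ·)
    (ContinuousMap.starSubalgebra_topologicalClosure_eq_top_of_separatesPoints A hsep)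

lemma exists_trigPoly_norm_sub_lt (g : C(Circle, ℂ)) {ε : ℝ} (hε : 0 < ε) :
    ∃ p ∈ trigPoly, ‖g - p‖ < ε := by
  have hg : g ∈ closure (trigPoly : Set C(Circle, ℂ)) := by
    rw [← Submodule.topologicalClosure_coe, trigPoly_dense]; trivial
  obtain ⟨p, hp, h⟩ := Metric.mem_closure_iff.1 hg ε hε
  exact ⟨p, hp, by rwa [← dist_eq_norm]⟩

lemma integrable_continuousMap (g : C(Circle, ℂ)) : Integrable g haar :=
  g.continuous.integrable_of_hasCompactSupport (HasCompactSupport.of_compactSpace _)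

lemma exists_trigPoly_integral_norm_sub_le {G : Circle → ℂ} (hG : Integrable G haar) {ε : ℝ}
    (hε : 0 < ε) : ∃ p ∈ trigPoly, ∫ z, ‖G z - p z‖ ∂haar ≤ ε := by
  obtain ⟨g, hg, hgi⟩ := hG.exists_boundedContinuous_integral_sub_le (half_pos hε)
  obtain ⟨p, hp, hgp⟩ := exists_trigPoly_norm_sub_lt g.toContinuousMap (half_pos hε)
  refine ⟨p, hp, ?_⟩
  have hpi := integrable_continuousMap p
  calc ∫ z, ‖G z - p z‖ ∂haar ≤ ∫ z, (‖G z - g z‖ + ε / 2) ∂haar := by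
        refine integral_mono (hG.sub hpi).norm ((hG.sub hgi).norm.add (integrable_const _))
          fun z => ?_
        have h1 : ‖g z - p z‖ ≤ ε / 2 :=
          ((g.toContinuousMap - p).norm_coe_le_norm z).trans hgp.le
        calc ‖G z - p z‖ = ‖(G z - g z) + (g z - p z)‖ := by congr 1; ring
          _ ≤ _ := (norm_add_le _ _).trans (by simpa using h1)
    _ ≤ ε := by
        have h2 : Integrable (fun z => ‖G z - g z‖) haar := (hG.sub hgi).norm
        rw [integral_add h2 (integrable_const _)]
        simp only [integral_const, probReal_univ, one_smul]
        linarith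

/-- Every essentially bounded function is the almost everywhere limit of a uniformly bounded
sequence of trigonometric polynomials. -/
lemma exists_trigPoly_tendsto_ae (f : Linf) :
    ∃ (p : ℕ → C(Circle, ℂ)) (M : ℝ), (∀ n, p n ∈ trigPoly) ∧ (∀ n, ‖p n‖ ≤ M) ∧
      ∀ᵐ z ∂haar, Tendsto (fun n => p n z) atTop (𝓝 (f z)) := by
  have hf1 : MemLp f 1 haar := (Lp.memLp f).mono_exponent le_top
  have hpos : ∀ n : ℕ, (0 : ℝ) < 1 / (n + 1) := fun n => Nat.one_div_pos_of_nat
  have happrox : ∀ n : ℕ, ∃ g : BoundedContinuousFunction Circle ℂ,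
      eLpNorm (⇑f - ⇑g) 1 haar ≤ ENNReal.ofReal (1 / (n + 1)) ∧ MemLp g 1 haar := fun n =>
    hf1.exists_boundedContinuous_eLpNorm_sub_le ENNReal.one_ne_top
      (by simpa using hpos n)
  choose g hg hgm using happrox
  have htend : Tendsto (fun n => eLpNorm (⇑(g n) - ⇑f) 1 haar) atTop (𝓝 0) := by
    refine tendsto_of_tendsto_of_tendsto_of_le_of_le tendsto_const_nhds
      (h := fun n : ℕ => ENNReal.ofReal (1 / (n + 1))) ?_ (fun n => zero_le) fun n => ?_
    · have := ENNReal.tendsto_ofReal (tendsto_one_div_add_atTop_nhds_zero_nat (𝕜 := ℝ))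
      simpa using this
    · rw [eLpNorm_sub_comm]; exact hg n
  obtain ⟨ns, -, hns⟩ := (tendstoInMeasure_of_tendsto_eLpNorm one_ne_zero
    (fun n => (hgm n).1) hf1.1 htend).exists_seq_tendsto_ae
  -- The retraction onto the ball of radius `M` makes the approximants uniformly bounded and fixes
  -- almost every value of `f`.
  set M : ℝ := ‖f‖ + 1 with hM
  have hM0 : 0 < M := by positivity
  let r : ℂ → ℂ := fun w => ((M / max M ‖w‖ : ℝ) : ℂ) * w
  have hmax : ∀ w : ℂ, max M ‖w‖ ≠ 0 := fun w => (hM0.trans_le (le_max_left _ _)).ne'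
  have hr : Continuous r := by
    refine (Complex.continuous_ofReal.comp ?_).mul continuous_id
    exact continuous_const.div (continuous_const.max continuous_norm) hmax
  have hrM : ∀ w, ‖r w‖ ≤ M := fun w => by
    simp only [r, norm_mul, Complex.norm_real, Real.norm_eq_abs]
    rw [abs_of_nonneg (by positivity), div_mul_eq_mul_div,
      div_le_iff₀ (hM0.trans_le (le_max_left _ _))]
    exact mul_le_mul_of_nonneg_left (le_max_right _ _) hM0.le
  have hrf : ∀ w : ℂ, ‖w‖ ≤ M → r w = w := fun w hw => by
    simp only [r, max_eq_left hw, div_self hM0.ne', Complex.ofReal_one, one_mul]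
  have hcont : ∀ n, ∃ p ∈ trigPoly,
      ‖(⟨fun z => r (g (ns n) z), hr.comp (g (ns n)).continuous⟩ : C(Circle, ℂ)) - p‖ <
        1 / ((n : ℝ) + 1) := fun n => exists_trigPoly_norm_sub_lt _ (hpos n)
  choose p hp hpn using hcont
  refine ⟨p, M + 1, hp, fun n => ?_, ?_⟩
  · refine (ContinuousMap.norm_le _ (by positivity)).2 fun z => ?_
    have h1 := ((_ : C(Circle, ℂ)).norm_coe_le_norm z).trans (hpn n).le
    have h2 : (1 : ℝ) / (n + 1) ≤ 1 := by
      rw [div_le_one (by positivity)]; linarith [(Nat.cast_nonneg n : (0 : ℝ) ≤ n)]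
    have h3 := hrM (g (ns n) z)
    simp only [ContinuousMap.sub_apply, ContinuousMap.coe_mk] at h1
    rw [norm_sub_rev] at h1
    have h4 := norm_add_le (p n z - r (g (ns n) z)) (r (g (ns n) z))
    rw [sub_add_cancel] at h4
    linarith
  · have hfM : ∀ᵐ z ∂haar, ‖f z‖ ≤ M := by
      have := ae_le_eLpNormEssSup (f := f) (μ := haar)
      filter_upwards [this] with z hz
      have h1 : ‖f z‖ₑ ≤ ENNReal.ofReal ‖f‖ := by
        rw [Lp.norm_def, ENNReal.ofReal_toReal (Lp.eLpNorm_ne_top f), eLpNorm_exponent_top]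
        exact hz
      rw [← ofReal_norm, ENNReal.ofReal_le_ofReal_iff (norm_nonneg _)] at h1
      linarith
    filter_upwards [hns, hfM] with z hz hzM
    have h1 : Tendsto (fun n => r (g (ns n) z)) atTop (𝓝 (f z)) := by
      have := (hr.tendsto (f z)).comp hz
      rwa [hrf _ hzM] at this
    have h2 : Tendsto (fun n => r (g (ns n) z) - p n z) atTop (𝓝 0) := by
      refine squeeze_zero_norm (fun n => ?_)
        (tendsto_one_div_add_atTop_nhds_zero_nat (𝕜 := ℝ))
      exact ((_ : C(Circle, ℂ)).norm_coe_le_norm z).trans (hpn n).le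
    simpa using h1.sub h2

/-! ### Asymptotic independence of `z ^ M` -/

lemma exists_isPrimitiveRoot_circle {M : ℕ} (hM : M ≠ 0) : ∃ ζ : Circle, IsPrimitiveRoot ζ M := by
  refine ⟨Circle.exp (2 * Real.pi / M),
    IsPrimitiveRoot.of_map_of_injective (f := Circle.coeHom) ?_ Circle.coe_injective⟩
  have h : Circle.coeHom (Circle.exp (2 * Real.pi / M)) =
      Complex.exp (2 * Real.pi * Complex.I / M) := by
    change ((Circle.exp (2 * Real.pi / M) : Circle) : ℂ) = _
    rw [Circle.coe_exp]; push_cast; congr 1; ring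
  rw [h]; exact Complex.isPrimitiveRoot_exp M hM

/-- Rotation by an `M`-th root of unity fixes `z ^ M` and multiplies `z ^ j` by a scalar other than
`1`, so the integral vanishes. -/
lemma integral_pow_mul_monomial_eq_zero {M : ℕ} {j : ℤ} (hM : M ≠ 0) (hj : ¬ (M : ℤ) ∣ j)
    (k : Circle → ℂ) : ∫ z, k (z ^ M) * monomial j z ∂haar = 0 := by
  obtain ⟨ζ, hprim⟩ := exists_isPrimitiveRoot_circle hM
  have hζ : ((ζ ^ j : Circle) : ℂ) ≠ 1 := by
    rw [← Circle.coe_one, Ne, Circle.coe_inj, hprim.zpow_eq_one_iff_dvd]; exact hj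
  have h := integral_mul_left_eq_self (μ := haar) (fun z => k (z ^ M) * monomial j z) ζ
  have h2 : ∀ z, k ((ζ * z) ^ M) * monomial j (ζ * z) =
      ((ζ ^ j : Circle) : ℂ) * (k (z ^ M) * monomial j z) := fun z => by
    rw [mul_pow, hprim.pow_eq_one, one_mul, monomial_apply, monomial_apply, mul_zpow,
      Circle.coe_mul]
    ring
  simp only [h2, integral_const_mul] at h
  have h3 : (((ζ ^ j : Circle) : ℂ) - 1) * ∫ z, k (z ^ M) * monomial j z ∂haar = 0 := by
    rw [sub_mul, h, one_mul, sub_self]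
  exact (mul_eq_zero.1 h3).resolve_left (sub_ne_zero.2 hζ)

lemma integral_monomial {j : ℤ} : ∫ z, monomial j z ∂haar = if j = 0 then 1 else 0 := by
  split_ifs with hj
  · simp [hj]
  · have h := integral_pow_mul_monomial_eq_zero (M := j.natAbs + 1) (j := j) (by omega)
      (fun h => by have := Int.natAbs_le_of_dvd_ne_zero h hj; omega) (fun _ => 1)
    simpa using h

lemma integrable_mul_of_norm_le_one {k G : Circle → ℂ} (hk : AEStronglyMeasurable k haar)
    (hk1 : ∀ z, ‖k z‖ ≤ 1) (hG : Integrable G haar) : Integrable (fun z => k z * G z) haar :=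
  hG.bdd_mul hk (Eventually.of_forall hk1)

lemma trigPoly_integral_pow_mul {p : C(Circle, ℂ)} (hp : p ∈ trigPoly) :
    ∃ n₀ : ℕ, 1 ≤ n₀ ∧ ∀ M ≥ n₀, ∀ k : Circle → ℂ, Measurable k → (∀ z, ‖k z‖ ≤ 1) →
      ∫ z, k (z ^ M) * p z ∂haar = (∫ z, k z ∂haar) * ∫ z, p z ∂haar := by
  have hint : ∀ (M : ℕ) (k : Circle → ℂ), Measurable k → (∀ z, ‖k z‖ ≤ 1) → ∀ q : C(Circle, ℂ),
      Integrable (fun z => k (z ^ M) * q z) haar := fun M k hk hk1 q =>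
    integrable_mul_of_norm_le_one (hk.comp (continuous_pow M).measurable).aestronglyMeasurable
      (fun z => hk1 _) (integrable_continuousMap q)
  induction hp using Submodule.span_induction with
  | mem x hx =>
    obtain ⟨j, rfl⟩ := hx
    refine ⟨j.natAbs + 1, by omega, fun M hM k hk hk1 => ?_⟩
    by_cases hj : j = 0
    · have : NeZero M := ⟨by omega⟩
      have h := (measurePreserving_pow M).map_eq
      have h2 : ∫ z, k (z ^ M) ∂haar = ∫ z, k z ∂haar := by
        conv_rhs => rw [← h]
        rw [integral_map (measurePreserving_pow M).aemeasurable hk.aestronglyMeasurable]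
      simp [hj, h2]
    · rw [integral_pow_mul_monomial_eq_zero (by omega)
        (fun h => by have := Int.natAbs_le_of_dvd_ne_zero h hj; omega), integral_monomial,
        if_neg hj, mul_zero]
  | zero => exact ⟨1, le_rfl, fun M _ k _ _ => by simp⟩
  | add p q _ _ hp hq =>
    obtain ⟨m, hm1, hm⟩ := hp
    obtain ⟨n, hn1, hn⟩ := hq
    refine ⟨max m n, by omega, fun M hM k hk hk1 => ?_⟩
    simp only [ContinuousMap.add_apply, mul_add]
    rw [integral_add (hint M k hk hk1 p) (hint M k hk hk1 q),
      integral_add (integrable_continuousMap p) (integrable_continuousMap q), mul_add,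
      hm M (by omega) k hk hk1, hn M (by omega) k hk hk1]
  | smul a p _ hp =>
    obtain ⟨m, hm1, hm⟩ := hp
    refine ⟨m, hm1, fun M hM k hk hk1 => ?_⟩
    simp only [ContinuousMap.smul_apply, smul_eq_mul, mul_left_comm _ a, integral_const_mul,
      hm M hM k hk hk1]

/-- As `M → ∞` the functions of `z ^ M` become independent of a given integrable `G`, uniformly
over test functions bounded by `1`. -/
lemma exists_norm_integral_pow_mul_sub_le {G : Circle → ℂ} (hG : Integrable G haar) {ε : ℝ}
    (hε : 0 < ε) : ∃ n₀ : ℕ, ∀ M ≥ n₀, ∀ k : Circle → ℂ, Measurable k → (∀ z, ‖k z‖ ≤ 1) →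
      ‖∫ z, k (z ^ M) * G z ∂haar - (∫ z, k z ∂haar) * ∫ z, G z ∂haar‖ ≤ ε := by
  obtain ⟨p, hp, hGp⟩ := exists_trigPoly_integral_norm_sub_le hG (half_pos hε)
  obtain ⟨n₀, -, hn₀⟩ := trigPoly_integral_pow_mul hp
  refine ⟨n₀, fun M hM k hk hk1 => ?_⟩
  have hpi := integrable_continuousMap p
  have hkM : AEStronglyMeasurable (fun z : Circle => k (z ^ M)) haar :=
    (hk.comp (continuous_pow M).measurable).aestronglyMeasurable
  have h1 : ‖∫ z, k (z ^ M) * (G z - p z) ∂haar‖ ≤ ε / 2 := by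
    refine (norm_integral_le_of_norm_le (hG.sub hpi).norm
      (Eventually.of_forall fun z => ?_)).trans hGp
    rw [norm_mul]
    exact mul_le_of_le_one_left (norm_nonneg _) (hk1 _)
  have h2 : ‖(∫ z, k z ∂haar) * ∫ z, (G z - p z) ∂haar‖ ≤ ε / 2 := by
    rw [norm_mul]
    have h3 : ‖∫ z, k z ∂haar‖ ≤ 1 := by
      refine (norm_integral_le_of_norm_le (integrable_const (1 : ℝ))
        (Eventually.of_forall hk1)).trans ?_
      simp
    exact (mul_le_of_le_one_left (norm_nonneg _) h3).trans
      ((norm_integral_le_integral_norm _).trans hGp)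
  have h4 : ∫ z, k (z ^ M) * G z ∂haar - (∫ z, k z ∂haar) * ∫ z, G z ∂haar =
      ∫ z, k (z ^ M) * (G z - p z) ∂haar - (∫ z, k z ∂haar) * ∫ z, (G z - p z) ∂haar := by
    have h5 := hn₀ M hM k hk hk1
    simp only [mul_sub]
    rw [integral_sub (integrable_mul_of_norm_le_one hkM (fun z => hk1 _) hG)
      (integrable_mul_of_norm_le_one hkM (fun z => hk1 _) hpi), integral_sub hG hpi, h5]
    ring
  rw [h4]
  exact (norm_sub_le _ _).trans (by linarith)

/-! ### Backward orbits of weighted composition operators -/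

section BackwardOrbit

variable {N : ℕ} {w : Circle → ℝ} {F : ℕ → Circle → ℂ}

lemma integral_pow_mul_eq_of_backwardOrbit
    (hw : ∀ q : Circle → ℂ, Measurable q → ∫ z, (w z : ℂ) * q (z ^ N) ∂haar = ∫ z, q z ∂haar)
    (hFm : ∀ n, Measurable (F n))
    (hrec : ∀ n, F n =ᵐ[haar] fun z => (w z : ℂ) * F (n + 1) (z ^ N)) (n : ℕ)
    {k : Circle → ℂ} (hk : Measurable k) :
    ∫ z, k (z ^ N ^ n) * F 0 z ∂haar = ∫ z, k z * F n z ∂haar := by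
  induction n generalizing k with
  | zero => simp
  | succ n ih =>
    have h := ih (k := fun z => k (z ^ N)) (hk.comp (continuous_pow N).measurable)
    simp only [← pow_mul, ← pow_succ] at h
    rw [h, ← hw (fun z => k z * F (n + 1) z) (hk.mul (hFm (n + 1)))]
    refine integral_congr_ae ?_
    filter_upwards [hrec n] with z hz
    rw [hz]; ring

lemma tendsto_integral_norm_sub_of_backwardOrbit (hN : 2 ≤ N)
    (hw : ∀ q : Circle → ℂ, Measurable q → ∫ z, (w z : ℂ) * q (z ^ N) ∂haar = ∫ z, q z ∂haar)
    (hFm : ∀ n, Measurable (F n)) (hFi : ∀ n, Integrable (F n) haar)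
    (hrec : ∀ n, F n =ᵐ[haar] fun z => (w z : ℂ) * F (n + 1) (z ^ N)) :
    Tendsto (fun n => ∫ z, ‖F n z - ∫ y, F 0 y ∂haar‖ ∂haar) atTop (𝓝 0) := by
  set c := ∫ y, F 0 y ∂haar with hc
  refine Metric.tendsto_atTop.2 fun ε hε => ?_
  obtain ⟨n₀, hn₀⟩ := exists_norm_integral_pow_mul_sub_le (hFi 0) (half_pos hε)
  refine ⟨n₀, fun n hn => ?_⟩
  -- Test against the phase of `F n - c`.
  let k : Circle → ℂ := fun z => conj (F n z - c) / ‖F n z - c‖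
  have hkm : Measurable k := by
    refine Measurable.div ?_ ?_
    · exact Complex.continuous_conj.measurable.comp ((hFm n).sub_const c)
    · exact Complex.measurable_ofReal.comp ((hFm n).sub_const c).norm
  have hk1 : ∀ z, ‖k z‖ ≤ 1 := fun z => by
    simp only [k, norm_div, RCLike.norm_conj, Complex.norm_real, norm_norm]
    exact div_self_le_one _
  have hkmul : ∀ z, k z * (F n z - c) = ((‖F n z - c‖ : ℝ) : ℂ) := fun z => by
    by_cases h : F n z - c = 0
    · simp [h]
    · have h' : ((‖F n z - c‖ : ℝ) : ℂ) ≠ 0 := by simpa using h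
      simp only [k]
      rw [div_mul_eq_mul_div, mul_comm, Complex.mul_conj, Complex.normSq_eq_norm_sq,
        div_eq_iff h']
      push_cast; ring
  have h1 := hn₀ (N ^ n) (hn.trans (Nat.lt_pow_self (by omega)).le) k hkm hk1
  rw [integral_pow_mul_eq_of_backwardOrbit hw hFm hrec n hkm, ← hc] at h1
  have hkF : Integrable (fun z => k z * F n z) haar :=
    integrable_mul_of_norm_le_one hkm.aestronglyMeasurable hk1 (hFi n)
  have hkc : Integrable (fun z => k z * c) haar :=
    integrable_mul_of_norm_le_one hkm.aestronglyMeasurable hk1 (integrable_const c)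
  rw [← integral_mul_const, ← integral_sub hkF hkc] at h1
  simp only [← mul_sub, hkmul] at h1
  rw [integral_complex_ofReal, Complex.norm_real] at h1
  rw [dist_zero_right]
  linarith

/-- A backward orbit of `F ↦ w(z) F(z ^ N)`, for a weight `w` that makes this operator isometric
on `L¹`, consists of constants: the `L¹` distance between two consecutive terms does not depend on
the index, and it tends to zero because all terms tend to their common mean. -/
lemma ae_eq_integral_of_backwardOrbit (hN : 2 ≤ N) (hw0 : ∀ z, 0 ≤ w z)
    (hw : ∀ q : Circle → ℂ, Measurable q → ∫ z, (w z : ℂ) * q (z ^ N) ∂haar = ∫ z, q z ∂haar)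
    (hFm : ∀ n, Measurable (F n)) (hFi : ∀ n, Integrable (F n) haar)
    (hrec : ∀ n, F n =ᵐ[haar] fun z => (w z : ℂ) * F (n + 1) (z ^ N)) :
    F 0 =ᵐ[haar] fun _ => ∫ z, F 0 z ∂haar := by
  have hwr : ∀ q : Circle → ℝ, Measurable q →
      ∫ z, w z * q (z ^ N) ∂haar = ∫ z, q z ∂haar := fun q hq => by
    have h := hw (fun z => (q z : ℂ)) (Complex.measurable_ofReal.comp hq)
    simp only [← Complex.ofReal_mul] at h
    rw [integral_complex_ofReal, integral_complex_ofReal] at h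
    exact_mod_cast h
  have htend := tendsto_integral_norm_sub_of_backwardOrbit hN hw hFm hFi hrec
  set c := ∫ y, F 0 y ∂haar
  have hstep : ∀ n, ∫ z, ‖F n z - F (n + 1) z‖ ∂haar =
      ∫ z, ‖F (n + 1) z - F (n + 2) z‖ ∂haar := fun n => by
    rw [← hwr (fun z => ‖F (n + 1) z - F (n + 2) z‖) ((hFm _).sub (hFm _)).norm]
    refine integral_congr_ae ?_
    filter_upwards [hrec n, hrec (n + 1)] with z h1 h2
    rw [h1, h2, ← mul_sub, norm_mul, Complex.norm_real, Real.norm_of_nonneg (hw0 z)]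
  have hdist : ∀ n, ∫ z, ‖F n z - F (n + 1) z‖ ∂haar = 0 := fun n => by
    have hconst : ∀ j, ∫ z, ‖F (n + j) z - F (n + j + 1) z‖ ∂haar =
        ∫ z, ‖F n z - F (n + 1) z‖ ∂haar := fun j => by
      induction j with
      | zero => rfl
      | succ j ih => rw [← ih]; exact (hstep (n + j)).symm
    have hle : ∀ j, ∫ z, ‖F n z - F (n + 1) z‖ ∂haar ≤
        ∫ z, ‖F (n + j) z - c‖ ∂haar + ∫ z, ‖F (n + j + 1) z - c‖ ∂haar := fun j => by
      have h1 : ∀ i, Integrable (fun z => ‖F i z - c‖) haar := fun i =>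
        ((hFi i).sub (integrable_const c)).norm
      rw [← hconst j, ← integral_add (h1 _) (h1 _)]
      refine integral_mono ((hFi _).sub (hFi _)).norm ((h1 _).add (h1 _)) fun z => ?_
      have h2 := norm_sub_le (F (n + j) z - c) (F (n + j + 1) z - c)
      rwa [sub_sub_sub_cancel_right] at h2
    have hlim : Tendsto (fun j => ∫ z, ‖F (n + j) z - c‖ ∂haar +
        ∫ z, ‖F (n + j + 1) z - c‖ ∂haar) atTop (𝓝 0) := by
      have h1 : Tendsto (fun j => n + j) atTop atTop := tendsto_add_atTop_nat n |>.congr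
        fun j => add_comm j n
      have h2 := (htend.comp h1).add (htend.comp ((tendsto_add_atTop_nat 1).comp h1))
      simpa using h2
    exact le_antisymm (ge_of_tendsto' hlim hle) (integral_nonneg fun z => norm_nonneg _)
  have haeq : ∀ n, F n =ᵐ[haar] F 0 := fun n => by
    induction n with
    | zero => rfl
    | succ n ih =>
      refine EventuallyEq.trans ?_ ih
      have h := (integral_eq_zero_iff_of_nonneg (fun z => norm_nonneg _)
        ((hFi n).sub (hFi (n + 1))).norm).1 (hdist n)
      filter_upwards [h] with z hz
      exact (sub_eq_zero.1 (norm_eq_zero.1 hz)).symm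
  have h0 : ∫ z, ‖F 0 z - c‖ ∂haar = 0 := by
    refine tendsto_nhds_unique (tendsto_const_nhds.congr fun n => ?_) htend
    refine integral_congr_ae ?_
    filter_upwards [haeq n] with z hz
    rw [hz]
  have h := (integral_eq_zero_iff_of_nonneg (fun z => norm_nonneg _)
    ((hFi 0).sub (integrable_const c)).norm).1 h0
  filter_upwards [h] with z hz
  exact sub_eq_zero.1 (norm_eq_zero.1 hz)

end BackwardOrbit

lemma measurable_coeFn {p : ℝ≥0∞} (f : Lp ℂ p haar) : Measurable f :=
  (Lp.stronglyMeasurable f).measurable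

/-- The products `f (n + i) * conj (f n)` form a backward orbit for the weight `|m|²`. -/
lemma mul_conj_ae_eq_integral_of_backwardOrbit {N : ℕ} (hN : 2 ≤ N) {m : Linf}
    (hm : ∀ q : Circle → ℂ, Measurable q →
      ∫ z, ((‖m z‖ ^ 2 : ℝ) : ℂ) * q (z ^ N) ∂haar = ∫ z, q z ∂haar)
    {f : ℕ → Lp ℂ 2 haar} (hrec : ∀ n, f n =ᵐ[haar] fun z => m z * f (n + 1) (z ^ N)) (i j : ℕ) :
    (fun z => f (j + i) z * conj (f j z)) =ᵐ[haar]
      fun _ => ∫ z, f (j + i) z * conj (f j z) ∂haar := by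
  have hint : ∀ n, Integrable (fun z => f (j + n + i) z * conj (f (j + n) z)) haar := fun n => by
    have h := L2.integrable_inner (𝕜 := ℂ) (f (j + n)) (f (j + n + i))
    simp only [RCLike.inner_apply] at h
    exact h
  have hmeas : ∀ n, Measurable (fun z => f (j + n + i) z * conj (f (j + n) z)) := fun n =>
    (measurable_coeFn _).mul (Complex.continuous_conj.measurable.comp (measurable_coeFn _))
  refine ae_eq_integral_of_backwardOrbit (N := N) (w := fun z => ‖m z‖ ^ 2)
    (F := fun n z => f (j + n + i) z * conj (f (j + n) z)) hN (fun z => by positivity) hm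
    hmeas hint fun n => ?_
  filter_upwards [hrec (j + n), hrec (j + n + i)] with z h2 h3
  have h4 : j + (n + 1) + i = j + n + i + 1 := by ring
  rw [h2, h3, map_mul, h4, ← add_assoc, Complex.ofReal_pow, ← Complex.conj_mul']
  ring

/-- If `f ↦ m(z) f(z ^ N)` is isometric on `L²`, a backward orbit of unit vectors exists only for
degenerate `m`: the rigidity of backward orbits in `L¹` applies both to `|f n|²` and to
`f n * conj (f (n + 1))`. -/
lemma isDegenerate_of_backwardOrbit {N : ℕ} (hN : 2 ≤ N) {m : Linf}
    (hm : ∀ q : Circle → ℂ, Measurable q →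
      ∫ z, ((‖m z‖ ^ 2 : ℝ) : ℂ) * q (z ^ N) ∂haar = ∫ z, q z ∂haar)
    {f : ℕ → Lp ℂ 2 haar} (hrec : ∀ n, f n =ᵐ[haar] fun z => m z * f (n + 1) (z ^ N))
    (h1 : ∀ n, ‖f n‖ = 1) : IsDegenerate N m := by
  have : NeZero N := ⟨by omega⟩
  have key := mul_conj_ae_eq_integral_of_backwardOrbit hN hm hrec
  have hnorm : ∀ j, ∀ᵐ z ∂haar, ‖f j z‖ = 1 := fun j => by
    have h2 : ∫ z, f (j + 0) z * conj (f j z) ∂haar = 1 := by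
      have h3 := inner_self_eq_norm_sq_to_K (𝕜 := ℂ) (f j)
      rw [L2.inner_def, h1 j] at h3
      simp only [RCLike.inner_apply, RCLike.ofReal_one, one_pow] at h3
      exact h3
    filter_upwards [key 0 j] with z hz
    rw [h2, add_zero, Complex.mul_conj'] at hz
    have h4 : ‖f j z‖ ^ 2 = 1 := by exact_mod_cast hz
    exact (pow_eq_one_iff_of_nonneg (norm_nonneg _) two_ne_zero).1 h4
  have hpow : ∀ᵐ z ∂haar, ‖f 1 (z ^ N)‖ = 1 :=
    (measurePreserving_pow N).quasiMeasurePreserving.tendsto_ae.eventually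
      (p := fun z => ‖f 1 z‖ = 1) (hnorm 1)
  have hm1 : ∀ᵐ z ∂haar, ‖m z‖ = 1 := by
    filter_upwards [hnorm 0, hpow, hrec 0] with z h2 h3 h4
    rw [h4, norm_mul, zero_add, h3, mul_one] at h2
    exact h2
  have hphase : ∀ x : ℂ, ‖x‖ = 1 → ((Circle.exp (Complex.arg x) : Circle) : ℂ) = x :=
      fun x hx => by
    have h2 := Complex.norm_mul_exp_arg_mul_I x
    rwa [hx, Complex.ofReal_one, one_mul] at h2
  set d : ℂ := ∫ z, f (0 + 1) z * conj (f 0 z) ∂haar with hd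
  have hfd : ∀ᵐ z ∂haar, f 0 z = conj d * f 1 z := by
    filter_upwards [key 1 0, hnorm 1] with z h2 h3
    rw [hd, ← h2, map_mul, Complex.conj_conj, zero_add, mul_right_comm, Complex.conj_mul', h3]
    simp
  have hd1 : ‖conj d‖ = 1 := by
    obtain ⟨z, h2, h3, h4⟩ := (hfd.and ((hnorm 0).and (hnorm 1))).exists
    rw [h2, norm_mul, h4, mul_one] at h3
    exact h3
  refine ⟨hm1, fun z => Circle.exp (Complex.arg (f 1 z)), Circle.exp (Complex.arg (conj d)),
    Circle.exp.continuous.measurable.comp (Complex.measurable_arg.comp (measurable_coeFn _)), ?_⟩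
  filter_upwards [hrec 0, hfd, hnorm 1, hpow] with z h2 h3 h4 h5
  rw [hphase _ h4, hphase _ h5, hphase _ hd1, ← h3, h2]

/-! ### The Hilbert space `L²(𝕋)` -/

/-- `L²(𝕋)`. -/
abbrev L2 : Type := Lp ℂ 2 haar

/-- The inclusion `L^∞(𝕋) ⊆ L²(𝕋)`. -/
def toL2 : Linf →ₗ[ℂ] L2 where
  toFun f := ((Lp.memLp f).mono_exponent le_top).toLp f
  map_add' f g := by
    rw [← MemLp.toLp_add]
    exact MemLp.toLp_congr _ _ (Lp.coeFn_add f g)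
  map_smul' c f := by
    rw [RingHom.id_apply, ← MemLp.toLp_const_smul]
    exact MemLp.toLp_congr _ _ (Lp.coeFn_smul c f)

lemma coeFn_toL2 (f : Linf) : toL2 f =ᵐ[haar] f :=
  MemLp.coeFn_toLp ((Lp.memLp f).mono_exponent le_top)

/-- Continuous functions as elements of `L^∞(𝕋)`. -/
def contLinf : C(Circle, ℂ) →L[ℂ] Linf := ContinuousMap.toLp ∞ haar ℂ

lemma coeFn_contLinf (p : C(Circle, ℂ)) : contLinf p =ᵐ[haar] p := ContinuousMap.coeFn_toLp haar p

lemma toL2_contLinf (p : C(Circle, ℂ)) :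
    toL2 (contLinf p) = ContinuousMap.toLp 2 haar ℂ p := by
  refine Lp.ext ?_
  filter_upwards [coeFn_toL2 (contLinf p), coeFn_contLinf p,
    ContinuousMap.coeFn_toLp (p := 2) (𝕜 := ℂ) haar p] with z h1 h2 h3
  rw [h1, h2, h3]

lemma dense_toL2_trigPoly :
    Dense ((fun p => toL2 (contLinf p)) '' (trigPoly : Set C(Circle, ℂ))) := by
  simp only [toL2_contLinf]
  refine (ContinuousMap.toLp_denseRange (p := 2) ℂ haar ℂ ENNReal.ofNat_ne_top).dense_image
    (ContinuousLinearMap.continuous _) ?_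
  rw [dense_iff_closure_eq, ← Submodule.topologicalClosure_coe, trigPoly_dense]
  simp

lemma denseRange_toL2 : DenseRange toL2 :=
  dense_toL2_trigPoly.mono (by rintro - ⟨p, -, rfl⟩; exact ⟨_, rfl⟩)

/-- Multiplication by a bounded function on `L²(𝕋)`. -/
def mulL2 (g : Linf) : L2 →L[ℂ] L2 := (ContinuousLinearMap.mul ℂ ℂ).holderL haar ∞ 2 2 g

lemma coeFn_mulL2 (g : Linf) (f : L2) : mulL2 g f =ᵐ[haar] fun z => g z * f z :=
  ContinuousLinearMap.coeFn_holder (ContinuousLinearMap.mul ℂ ℂ) g f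

/-- The isometry `f ↦ f(z ^ N)` of `L²(𝕋)`. -/
def dilateL2 (N : ℕ) [NeZero N] : L2 →ₗᵢ[ℂ] L2 :=
  Lp.compMeasurePreservingₗᵢ ℂ (fun z : Circle => z ^ N) (measurePreserving_pow N)

lemma coeFn_dilateL2 (N : ℕ) [NeZero N] (f : L2) :
    dilateL2 N f =ᵐ[haar] fun z => f (z ^ N) :=
  Lp.coeFn_compMeasurePreserving f (measurePreserving_pow N)

lemma coeFn_dilate (N : ℕ) [NeZero N] (f : Linf) : dilate N f =ᵐ[haar] fun z => f (z ^ N) :=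
  Lp.coeFn_compMeasurePreserving f (measurePreserving_pow N)

lemma ae_comp_pow (N : ℕ) [NeZero N] {p : Circle → Prop} (h : ∀ᵐ z ∂haar, p z) :
    ∀ᵐ z ∂haar, p (z ^ N) :=
  (measurePreserving_pow N).quasiMeasurePreserving.tendsto_ae.eventually (p := p) h

lemma mulL2_toL2 (g f : Linf) : mulL2 g (toL2 f) = toL2 (Linf.mul g f) := by
  refine Lp.ext ?_
  filter_upwards [coeFn_mulL2 g (toL2 f), coeFn_toL2 f, coeFn_toL2 (Linf.mul g f),
    Linf.coeFn_mul g f] with z h1 h2 h3 h4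
  rw [h1, h2, h3, h4]

lemma dilateL2_toL2 (N : ℕ) [NeZero N] (f : Linf) : dilateL2 N (toL2 f) = toL2 (dilate N f) := by
  refine Lp.ext ?_
  filter_upwards [coeFn_dilateL2 N (toL2 f), ae_comp_pow N (coeFn_toL2 f),
    coeFn_toL2 (dilate N f), coeFn_dilate N f] with z h1 h2 h3 h4
  rw [h1, h2, h3, h4]

lemma Linf.mul_comm (f g : Linf) : Linf.mul f g = Linf.mul g f := by
  refine Lp.ext ?_
  filter_upwards [Linf.coeFn_mul f g, Linf.coeFn_mul g f] with z h1 h2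
  rw [h1, h2, _root_.mul_comm]

namespace WaveletRep

variable {N : ℕ} [N.AtLeastTwo] {H : Type*} [NormedAddCommGroup H] [InnerProductSpace ℂ H]
  [CompleteSpace H] (ρ : WaveletRep N H)

/-! ### Elementary operator identities -/

lemma U_inv_apply_U (x : H) :
    ((ρ.U⁻¹ : unitary (H →L[ℂ] H)) : H →L[ℂ] H) ((ρ.U : H →L[ℂ] H) x) = x := by
  rw [← mul_apply_eq_comp, ← Submonoid.coe_mul, inv_mul_cancel]; rfl

lemma U_apply_U_inv (x : H) :
    (ρ.U : H →L[ℂ] H) (((ρ.U⁻¹ : unitary (H →L[ℂ] H)) : H →L[ℂ] H) x) = x := by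
  rw [← mul_apply_eq_comp, ← Submonoid.coe_mul, mul_inv_cancel]; rfl

lemma U_π_apply (f : Linf) (x : H) :
    (ρ.U : H →L[ℂ] H) (ρ.π f x) = ρ.π (dilate N f) ((ρ.U : H →L[ℂ] H) x) := by
  rw [← ρ.covariance f]
  simp only [mul_apply_eq_comp, U_inv_apply_U]

lemma π_mul_apply (f g : Linf) (x : H) : ρ.π (Linf.mul f g) x = ρ.π f (ρ.π g x) := by
  rw [ρ.map_mul]; rfl

lemma π_one_apply (x : H) : ρ.π Linf.one x = x := by
  rw [ρ.map_one]; rfl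

lemma inner_π_left (f : Linf) (x y : H) :
    inner ℂ (ρ.π f x) y = inner ℂ x (ρ.π (star f) y) := by
  rw [ρ.map_star, ContinuousLinearMap.star_eq_adjoint, ContinuousLinearMap.adjoint_inner_right]

lemma inner_U_U (x y : H) :
    inner ℂ ((ρ.U : H →L[ℂ] H) x) ((ρ.U : H →L[ℂ] H) y) = inner ℂ x y := by
  have h : (star (ρ.U : H →L[ℂ] H)) * (ρ.U : H →L[ℂ] H) = 1 := Unitary.coe_star_mul_self ρ.U
  rw [← ContinuousLinearMap.adjoint_inner_right, ← ContinuousLinearMap.star_eq_adjoint,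
    ← mul_apply_eq_comp, h]; rfl

lemma norm_U (x : H) : ‖(ρ.U : H →L[ℂ] H) x‖ = ‖x‖ := by
  rw [@norm_eq_sqrt_re_inner ℂ, inner_U_U, ← @norm_eq_sqrt_re_inner ℂ]

lemma π_monomial (k : ℤ) :
    ρ.π (contLinf (monomial k)) = ((ρ.T ^ k : unitary (H →L[ℂ] H)) : H →L[ℂ] H) := by
  have hadd : ∀ a b : ℤ, ρ.π (contLinf (monomial (a + b))) =
      ρ.π (contLinf (monomial a)) * ρ.π (contLinf (monomial b)) := fun a b => by
    rw [← ρ.map_mul]; refine congrArg ρ.π (Lp.ext ?_)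
    filter_upwards [coeFn_contLinf (monomial (a + b)), coeFn_contLinf (monomial a),
      coeFn_contLinf (monomial b), Linf.coeFn_mul (contLinf (monomial a)) (contLinf (monomial b))]
      with z h1 h2 h3 h4
    rw [h1, h4, h2, h3]; simp [zpow_add]
  have h0 : ρ.π (contLinf (monomial 0)) = 1 := by
    rw [← ρ.map_one]; refine congrArg ρ.π (Lp.ext ?_)
    filter_upwards [coeFn_contLinf (monomial 0), Linf.coeFn_one] with z h1 h2
    rw [h1, h2]; simp
  have h1 : ρ.π (contLinf (monomial 1)) = (ρ.T : H →L[ℂ] H) := by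
    change _ = ρ.π Linf.z
    refine congrArg ρ.π (Lp.ext ?_)
    filter_upwards [coeFn_contLinf (monomial 1), Linf.coeFn_z] with z h1 h2
    rw [h1, h2]; simp
  have hneg : ρ.π (contLinf (monomial (-1))) = ((ρ.T⁻¹ : unitary (H →L[ℂ] H)) : H →L[ℂ] H) := by
    have h2 : ρ.π (contLinf (monomial (-1))) * (ρ.T : H →L[ℂ] H) = 1 := by
      rw [← h1, ← hadd, neg_add_cancel, h0]
    have h3 : (ρ.T : H →L[ℂ] H) * ((ρ.T⁻¹ : unitary (H →L[ℂ] H)) : H →L[ℂ] H) = 1 := by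
      rw [← Submonoid.coe_mul, mul_inv_cancel, Submonoid.coe_one]
    exact left_inv_eq_right_inv h2 h3
  induction k using Int.induction_on with
  | zero => rw [h0, zpow_zero]; rfl
  | succ n ih => rw [hadd, ih, h1, zpow_add, zpow_one, Submonoid.coe_mul]
  | pred n ih => rw [sub_eq_add_neg, hadd, ih, hneg, zpow_add, zpow_neg_one, Submonoid.coe_mul]

/-- The closed span of the translates of `φ`. -/
def translateSpan (φ : H) : Submodule ℂ H :=
  (Submodule.span ℂ (Set.range
    fun k : ℤ => ((ρ.T ^ k : unitary (H →L[ℂ] H)) : H →L[ℂ] H) φ)).topologicalClosure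

lemma π_trigPoly_mem (φ : H) {p : C(Circle, ℂ)} (hp : p ∈ trigPoly) :
    ρ.π (contLinf p) φ ∈ ρ.translateSpan φ := by
  refine Submodule.le_topologicalClosure _ ?_
  induction hp using Submodule.span_induction with
  | mem x hx =>
    obtain ⟨k, rfl⟩ := hx
    rw [π_monomial]; exact Submodule.subset_span ⟨k, rfl⟩
  | zero => simp
  | add p q _ _ hp hq =>
    rw [map_add, map_add, add_apply]; exact add_mem hp hq
  | smul a p _ hp =>
    rw [map_smul, map_smul, smul_apply]; exact Submodule.smul_mem _ a hp

/-! ### The isometry `L²(𝕋) → H` attached to a vector with correlation function `1` -/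

/-- The linear map `f ↦ π(f) φ` on `L^∞(𝕋)`. -/
def orbitMap (φ : H) : Linf →ₗ[ℂ] H := (ContinuousLinearMap.apply ℂ H φ).toLinearMap ∘ₗ ρ.π

/-- The continuous extension of `f ↦ π(f) φ` to `L²(𝕋)`; it is only meaningful when
`‖π(f) φ‖` is bounded by a multiple of the `L²` norm of `f`. -/
def synthesis (φ : H) : L2 →L[ℂ] H := (ρ.orbitMap φ).extendOfNorm toL2

section Synthesis

variable {ρ} {φ : H} (hφ : ∀ f : Linf, inner ℂ φ (ρ.π f φ) = ∫ z, f z ∂haar)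

include hφ

lemma norm_π_apply (f : Linf) : ‖ρ.π f φ‖ = ‖toL2 f‖ := by
  have h : inner ℂ (ρ.π f φ) (ρ.π f φ) = inner ℂ (toL2 f) (toL2 f) := by
    rw [inner_π_left, ← π_mul_apply, hφ, L2.inner_def]
    refine integral_congr_ae ?_
    filter_upwards [coeFn_toL2 f, Linf.coeFn_mul (star f) f, Lp.coeFn_star f] with z h1 h2 h3
    rw [h1, h2, h3, Pi.star_apply, RCLike.inner_apply, _root_.mul_comm]; rfl
  rw [@norm_eq_sqrt_re_inner ℂ, h, ← @norm_eq_sqrt_re_inner ℂ]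

lemma synthesis_toL2 (f : Linf) : ρ.synthesis φ (toL2 f) = ρ.π f φ :=
  LinearMap.extendOfNorm_eq denseRange_toL2
    ⟨1, fun f => by rw [one_mul]; exact (norm_π_apply hφ f).le⟩ f

lemma norm_synthesis (f : L2) : ‖ρ.synthesis φ f‖ = ‖f‖ := by
  refine congrFun (denseRange_toL2.equalizer (g := fun f => ‖ρ.synthesis φ f‖)
    (h := fun f => ‖f‖) (by fun_prop) (by fun_prop) (funext fun f => ?_)) f
  simp only [Function.comp_apply, synthesis_toL2 hφ, norm_π_apply hφ]

lemma inner_synthesis (f g : L2) :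
    inner ℂ (ρ.synthesis φ f) (ρ.synthesis φ g) = inner ℂ f g :=
  LinearIsometry.inner_map_map
    ({ (ρ.synthesis φ).toLinearMap with norm_map' := norm_synthesis hφ } : L2 →ₗᵢ[ℂ] H) f g

lemma synthesis_injective : Function.Injective (ρ.synthesis φ) :=
  ({ (ρ.synthesis φ).toLinearMap with norm_map' := norm_synthesis hφ } : L2 →ₗᵢ[ℂ] H).injective

lemma π_synthesis (g : Linf) (f : L2) :
    ρ.π g (ρ.synthesis φ f) = ρ.synthesis φ (mulL2 g f) := by
  refine congrFun (denseRange_toL2.equalizer (g := fun f => ρ.π g (ρ.synthesis φ f))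
    (h := fun f => ρ.synthesis φ (mulL2 g f)) (by fun_prop) (by fun_prop) (funext fun f => ?_)) f
  simp only [Function.comp_apply, mulL2_toL2, synthesis_toL2 hφ, π_mul_apply]

lemma U_synthesis {m : Linf} (hm : (ρ.U : H →L[ℂ] H) φ = ρ.π m φ) (f : L2) :
    (ρ.U : H →L[ℂ] H) (ρ.synthesis φ f) = ρ.synthesis φ (mulL2 m (dilateL2 N f)) := by
  refine congrFun (denseRange_toL2.equalizer
    (g := fun f => (ρ.U : H →L[ℂ] H) (ρ.synthesis φ f))
    (h := fun f => ρ.synthesis φ (mulL2 m (dilateL2 N f))) (by fun_prop)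
    ((ρ.synthesis φ).continuous.comp ((mulL2 m).continuous.comp (dilateL2 N).continuous))
    (funext fun f => ?_)) f
  simp only [Function.comp_apply, dilateL2_toL2, mulL2_toL2, synthesis_toL2 hφ]
  rw [U_π_apply, hm, ← π_mul_apply, Linf.mul_comm]

lemma range_synthesis :
    LinearMap.range (ρ.synthesis φ).toLinearMap = ρ.translateSpan φ := by
  refine le_antisymm ?_ ?_
  · rintro - ⟨f, rfl⟩
    have hcl : IsClosed {f : L2 | ρ.synthesis φ f ∈ ρ.translateSpan φ} :=
      (Submodule.isClosed_topologicalClosure _).preimage (ρ.synthesis φ).continuous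
    have h := closure_minimal (s := (fun p => toL2 (contLinf p)) ''
      (trigPoly : Set C(Circle, ℂ))) ?_ hcl (dense_toL2_trigPoly f)
    · exact h
    · rintro - ⟨p, hp, rfl⟩
      rw [Set.mem_ofPred_eq, synthesis_toL2 hφ]
      exact ρ.π_trigPoly_mem φ hp
  · refine Submodule.topologicalClosure_minimal _ (Submodule.span_le.2 ?_) ?_
    · rintro - ⟨k, rfl⟩
      refine ⟨toL2 (contLinf (monomial k)), ?_⟩
      simp only [← π_monomial]
      exact synthesis_toL2 hφ _
    · exact (AddMonoidHomClass.isometry_of_norm (ρ.synthesis φ)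
        (norm_synthesis hφ)).isClosedEmbedding.isClosed_range

lemma mem_translateSpan {x : H} :
    x ∈ ρ.translateSpan φ ↔ ∃ f : L2, ρ.synthesis φ f = x := by
  rw [← range_synthesis hφ]; rfl

end Synthesis

end WaveletRep

/-! ### The quadrature condition on the filter -/

/-- The quadrature condition on a filter `m`: the map `z ↦ z ^ N` carries the measure `|m|² dμ` to
Haar measure `μ`. Equivalently, the average of `|m|²` over almost every fibre of `z ↦ z ^ N` is
`1`. -/
def IsQuadrature (N : ℕ) (m : Circle → ℂ) : Prop :=
  MeasurePreserving (fun z : Circle => z ^ N) (haar.withDensity fun z => ‖m z‖ₑ ^ 2) haar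

lemma IsQuadrature.integral {N : ℕ} {m : Circle → ℂ} (hmm : Measurable m) (h : IsQuadrature N m)
    {q : Circle → ℂ} (hq : Measurable q) :
    ∫ z, ((‖m z‖ ^ 2 : ℝ) : ℂ) * q (z ^ N) ∂haar = ∫ z, q z ∂haar := by
  have h1 := integral_map (μ := haar.withDensity fun z => ‖m z‖ₑ ^ 2)
    h.measurable.aemeasurable (f := q) hq.aestronglyMeasurable
  rw [h.map_eq, integral_withDensity_eq_integral_toReal_smul (by fun_prop)
    (Eventually.of_forall fun z => by finiteness)] at h1
  rw [h1]
  refine integral_congr_ae (Eventually.of_forall fun z => ?_)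
  simp

/-- The image `A` of a measurable set `E` under `z ↦ z ^ N` is measurable, of measure at most
`N * haar E`: its preimage is the union of the `N` rotations of `E` by roots of unity, and
`z ↦ z ^ N` preserves Haar measure. -/
lemma exists_measurableSet_pow_preimage {N : ℕ} (hN : N ≠ 0) {E : Set Circle}
    (hE : MeasurableSet E) :
    ∃ A : Set Circle, MeasurableSet A ∧ E ⊆ (fun z : Circle => z ^ N) ⁻¹' A ∧
      haar A ≤ N * haar E := by
  have : NeZero N := ⟨hN⟩
  obtain ⟨ζ, hprim⟩ := exists_isPrimitiveRoot_circle hN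
  have hprimC : IsPrimitiveRoot (ζ : ℂ) N :=
    hprim.map_of_injective (f := Circle.coeHom) Circle.coe_injective
  have hroot : ∀ u v : Circle, u ^ N = v ^ N → ∃ i < N, ζ ^ i * v = u := fun u v huv => by
    have h1 : ((u / v : Circle) : ℂ) ^ N = 1 := by
      rw [← Circle.coe_pow, div_pow, huv, div_self', Circle.coe_one]
    obtain ⟨i, hi, h2⟩ := hprimC.eq_pow_of_pow_eq_one h1
    refine ⟨i, hi, ?_⟩
    rw [← Circle.coe_pow, Circle.coe_inj] at h2
    rw [h2, div_mul_cancel]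
  -- A measurable section of `z ↦ z ^ N`.
  let σ : Circle → Circle := fun w => Circle.exp (Complex.arg w / N)
  have hcoe : Continuous (fun z : Circle => (z : ℂ)) := by fun_prop
  have hσm : Measurable σ := Circle.exp.continuous.measurable.comp
    ((Complex.measurable_arg.comp hcoe.measurable).div_const _)
  have hσ : ∀ w, σ w ^ N = w := fun w => by
    have h : (N : ℝ) * (Complex.arg w / N) = Complex.arg w := by
      have : (N : ℝ) ≠ 0 := Nat.cast_ne_zero.mpr hN
      field_simp
    change Circle.exp (Complex.arg w / N) ^ N = w
    rw [← Circle.exp_natCast_mul, h, Circle.exp_arg]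
  set A : Set Circle := ⋃ i ∈ Finset.range N, {w | ζ ^ i * σ w ∈ E} with hA
  have hAm : MeasurableSet A := by
    refine Finset.measurableSet_biUnion _ fun i _ => ?_
    exact (hσm.const_mul (ζ ^ i)) hE
  refine ⟨A, hAm, fun z hz => ?_, ?_⟩
  · obtain ⟨i, hi, h⟩ := hroot z (σ (z ^ N)) (hσ _).symm
    simp only [hA, Set.mem_preimage, Set.mem_iUnion, Finset.mem_range]
    exact ⟨i, hi, by rwa [Set.mem_ofPred_eq, h]⟩
  · have hsub : (fun z : Circle => z ^ N) ⁻¹' A ⊆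
        ⋃ i ∈ Finset.range N, (fun z => ζ ^ i * z) ⁻¹' E := fun z hz => by
      simp only [hA, Set.mem_preimage, Set.mem_iUnion, Finset.mem_range] at hz ⊢
      obtain ⟨i, -, h⟩ := hz
      obtain ⟨j, hj, h2⟩ := hroot (ζ ^ i * σ (z ^ N)) z (by
        rw [mul_pow, hσ, pow_right_comm, hprim.pow_eq_one, one_pow, one_mul])
      exact ⟨j, hj, by rw [h2]; exact h⟩
    calc haar A = haar ((fun z : Circle => z ^ N) ⁻¹' A) :=
          ((measurePreserving_pow N).measure_preimage hAm.nullMeasurableSet).symm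
      _ ≤ ∑ i ∈ Finset.range N, haar ((fun z => ζ ^ i * z) ⁻¹' E) :=
          (measure_mono hsub).trans (measure_biUnion_finset_le _ _)
      _ = N * haar E := by simp [measure_preimage_mul]

lemma IsQuadrature.ae_le {N : ℕ} (hN : N ≠ 0) {m : Circle → ℂ} (hmm : Measurable m)
    (h : IsQuadrature N m) : ∀ᵐ z ∂haar, ‖m z‖ₑ ^ 2 ≤ N := by
  refine ae_le_of_forall_setLIntegral_le_of_sigmaFinite (by fun_prop) fun E hE _ => ?_
  obtain ⟨A, hA, hEA, hAE⟩ := exists_measurableSet_pow_preimage hN hE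
  calc ∫⁻ z in E, ‖m z‖ₑ ^ 2 ∂haar = (haar.withDensity fun z => ‖m z‖ₑ ^ 2) E :=
        (withDensity_apply _ hE).symm
    _ ≤ (haar.withDensity fun z => ‖m z‖ₑ ^ 2) ((fun z : Circle => z ^ N) ⁻¹' A) :=
        measure_mono hEA
    _ = haar A := MeasurePreserving.measure_preimage h hA.nullMeasurableSet
    _ ≤ N * haar E := hAE
    _ = ∫⁻ _ in E, (N : ℝ≥0∞) ∂haar := by simp

lemma IsQuadrature.exists_toL2_eq {N : ℕ} (hN : N ≠ 0) {m : L2} (h : IsQuadrature N m) :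
    ∃ m' : Linf, toL2 m' = m := by
  have hb : MemLp m ∞ haar := by
    refine memLp_top_of_bound (Lp.aestronglyMeasurable m) (Real.sqrt N) ?_
    filter_upwards [h.ae_le hN (measurable_coeFn m)] with z hz
    refine Real.le_sqrt_of_sq_le ?_
    have h2 := ENNReal.toReal_mono (by finiteness) hz
    simpa using h2
  refine ⟨hb.toLp m, Lp.ext ?_⟩
  filter_upwards [coeFn_toL2 (hb.toLp m), hb.coeFn_toLp] with z h1 h2
  rw [h1, h2]

namespace WaveletRep

variable {N : ℕ} [N.AtLeastTwo] {H : Type*} [NormedAddCommGroup H] [InnerProductSpace ℂ H]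
  [CompleteSpace H] {ρ : WaveletRep N H} {φ : H}

/-- `U φ` and `φ` give the same vector state up to `f ↦ f(z ^ N)`; on the function side this is the
quadrature condition. -/
lemma isQuadrature_of_U_eq (hφ : ∀ f : Linf, inner ℂ φ (ρ.π f φ) = ∫ z, f z ∂haar) {m : L2}
    (hm : (ρ.U : H →L[ℂ] H) φ = ρ.synthesis φ m) : IsQuadrature N m := by
  refine ⟨(continuous_pow N).measurable, Measure.ext fun A hA => ?_⟩
  have hPA : MeasurableSet ((fun z : Circle => z ^ N) ⁻¹' A) := (continuous_pow N).measurable hA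
  let g : Linf := indicatorConstLp ∞ hA (measure_ne_top haar A) (1 : ℂ)
  have hg : g =ᵐ[haar] A.indicator fun _ => (1 : ℂ) := indicatorConstLp_coeFn
  have hint : Integrable (fun z => ‖m z‖ ^ 2) haar :=
    (memLp_two_iff_integrable_sq_norm (Lp.aestronglyMeasurable m)).1 (Lp.memLp m)
  have h1 : inner ℂ m (mulL2 (dilate N g) m) = ∫ z, g z ∂haar := by
    rw [← inner_synthesis hφ, ← π_synthesis hφ, ← hm, ← U_π_apply, inner_U_U, hφ]
  have h2 : ∫ z in (fun z : Circle => z ^ N) ⁻¹' A, ‖m z‖ ^ 2 ∂haar = haar.real A := by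
    have h3 : inner ℂ m (mulL2 (dilate N g) m) =
        ((∫ z in (fun z : Circle => z ^ N) ⁻¹' A, ‖m z‖ ^ 2 ∂haar : ℝ) : ℂ) := by
      rw [L2.inner_def, ← integral_indicator hPA, ← integral_complex_ofReal]
      refine integral_congr_ae ?_
      filter_upwards [coeFn_mulL2 (dilate N g) m, coeFn_dilate N g, ae_comp_pow N hg]
        with z h4 h5 h6
      rw [h4, h5, h6, RCLike.inner_apply]
      by_cases hz : z ^ N ∈ A
      · rw [Set.indicator_of_mem hz, Set.indicator_of_mem (by exact hz), one_mul, Complex.mul_conj']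
        push_cast; rfl
      · rw [Set.indicator_of_notMem hz, Set.indicator_of_notMem (by exact hz)]; simp
    have h4 : ∫ z, g z ∂haar = ((haar.real A : ℝ) : ℂ) := by
      rw [integral_congr_ae hg, integral_indicator_const _ hA]; simp
    rw [h3, h4] at h1
    exact_mod_cast h1
  rw [Measure.map_apply (continuous_pow N).measurable hA, withDensity_apply _ hPA]
  have h5 : ∀ z, ‖m z‖ₑ ^ 2 = ENNReal.ofReal (‖m z‖ ^ 2) := fun z => by
    rw [ENNReal.ofReal_pow (norm_nonneg _), ofReal_norm]
  simp only [h5]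
  rw [← ofReal_integral_eq_lintegral_ofReal hint.integrableOn
    (Eventually.of_forall fun z => by positivity), h2, ofReal_measureReal]

end WaveletRep

namespace WaveletRep

variable {N : ℕ} [N.AtLeastTwo] {H : Type*} [NormedAddCommGroup H] [InnerProductSpace ℂ H]
  [CompleteSpace H] {ρ : WaveletRep N H} {φ : H}

/-! ### Orthonormality of the translates -/

lemma exists_correlation_eq_one_iff :
    (∃ h : Circle → ℂ, ρ.IsCorrelationFunction φ φ h ∧ ∀ᵐ z ∂haar, h z = 1) ↔
      ∀ f : Linf, inner ℂ φ (ρ.π f φ) = ∫ z, f z ∂haar := by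
  constructor
  · rintro ⟨h, ⟨-, hh⟩, h1⟩ f
    rw [hh f]
    refine integral_congr_ae ?_
    filter_upwards [h1] with z hz
    rw [hz, mul_one]
  · intro hφ
    exact ⟨fun _ => 1, ⟨integrable_const 1, fun f => by simp [hφ f]⟩, by simp⟩

lemma orthonormal_translates (hφ : ∀ f : Linf, inner ℂ φ (ρ.π f φ) = ∫ z, f z ∂haar) :
    Orthonormal ℂ (fun k : ℤ => ((ρ.T ^ k : unitary (H →L[ℂ] H)) : H →L[ℂ] H) φ) := by
  rw [orthonormal_iff_ite]
  intro i j
  simp only [← π_monomial]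
  rw [← synthesis_toL2 hφ, ← synthesis_toL2 hφ, inner_synthesis hφ, L2.inner_def]
  have h : ∫ z, monomial (j - i) z ∂haar = if i = j then 1 else 0 := by
    rw [integral_monomial]; simp only [sub_eq_zero, eq_comm]
  rw [← h]
  refine integral_congr_ae ?_
  filter_upwards [coeFn_toL2 (contLinf (monomial i)), coeFn_toL2 (contLinf (monomial j)),
    coeFn_contLinf (monomial i), coeFn_contLinf (monomial j)] with z h1 h2 h3 h4
  rw [h1, h2, h3, h4, RCLike.inner_apply]
  simp only [monomial_apply, zpow_sub, Circle.coe_mul, Circle.coe_inv_eq_conj]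

/-- Orthonormality gives the formula for trigonometric polynomials, and normality extends it to
bounded almost everywhere limits. -/
lemma inner_π_of_orthonormal (hρ : ρ.IsNormal)
    (hφ : Orthonormal ℂ (fun k : ℤ => ((ρ.T ^ k : unitary (H →L[ℂ] H)) : H →L[ℂ] H) φ))
    (f : Linf) : inner ℂ φ (ρ.π f φ) = ∫ z, f z ∂haar := by
  have htrig : ∀ p ∈ trigPoly, inner ℂ φ (ρ.π (contLinf p) φ) = ∫ z, p z ∂haar := fun p hp => by
    induction hp using Submodule.span_induction with
    | mem x hx =>
      obtain ⟨k, rfl⟩ := hx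
      have h := (orthonormal_iff_ite.1 hφ) 0 k
      rw [π_monomial, integral_monomial]
      simpa [eq_comm] using h
    | zero => simp
    | add p q _ _ hp hq =>
      simp only [map_add, add_apply, inner_add_right, hp, hq, ContinuousMap.add_apply]
      rw [integral_add (integrable_continuousMap p) (integrable_continuousMap q)]
    | smul a p _ hp =>
      simp only [map_smul, smul_apply, inner_smul_right, hp, ContinuousMap.smul_apply, smul_eq_mul,
        integral_const_mul]
  obtain ⟨p, M, hp, hM, hlim⟩ := exists_trigPoly_tendsto_ae f
  have hM0 : 0 ≤ M := (norm_nonneg _).trans (hM 0)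
  have hpM : ∀ n z, ‖p n z‖ ≤ M := fun n z => ((p n).norm_coe_le_norm z).trans (hM n)
  have hae : ∀ᵐ z ∂haar, ∀ n, contLinf (p n) z = p n z :=
    ae_all_iff.2 fun n => coeFn_contLinf (p n)
  have h1 : Tendsto (fun n => ρ.π (contLinf (p n)) φ) atTop (𝓝 (ρ.π f φ)) := by
    refine hρ _ f M (fun n => ?_) ?_ φ
    · have h := Lp.norm_le_of_ae_bound (f := contLinf (p n)) hM0
        (by filter_upwards [hae] with z hz; rw [hz]; exact hpM n z)
      simpa using h
    · filter_upwards [hae, hlim] with z h2 h3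
      simpa only [h2] using h3
  have h2 : Tendsto (fun n => ∫ z, p n z ∂haar) atTop (𝓝 (∫ z, f z ∂haar)) :=
    tendsto_integral_of_dominated_convergence (fun _ => M)
      (fun n => (p n).continuous.aestronglyMeasurable) (integrable_const M)
      (fun n => Eventually.of_forall (hpM n)) hlim
  refine tendsto_nhds_unique ((tendsto_const_nhds (x := φ)).inner h1) ?_
  simpa only [htrig _ (hp _)] using h2

/-! ### From a multiresolution analysis to the three conditions -/

section OfMRA

variable {V : ℤ → Submodule ℂ H} (hV : ρ.IsMRAWith V φ)

include hV

lemma IsMRAWith.monotone : Monotone V := monotone_int_of_le_succ hV.le_succ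

lemma IsMRAWith.U_mem {n : ℤ} {x : H} (hx : x ∈ V n) : (ρ.U : H →L[ℂ] H) x ∈ V (n - 1) := by
  rw [← hV.map_U]; exact ⟨x, hx, rfl⟩

lemma IsMRAWith.zero_eq : V 0 = ρ.translateSpan φ := hV.closure_span.symm

lemma IsMRAWith.exists_U_eq (hφ : ∀ f : Linf, inner ℂ φ (ρ.π f φ) = ∫ z, f z ∂haar) :
    ∃ m : Linf, (ρ.U : H →L[ℂ] H) φ = ρ.π m φ := by
  have h := hV.monotone (show (0 - 1 : ℤ) ≤ 0 by norm_num) (hV.U_mem hV.mem_zero)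
  rw [hV.zero_eq, mem_translateSpan hφ] at h
  obtain ⟨m, hm⟩ := h
  obtain ⟨m', rfl⟩ := (isQuadrature_of_U_eq hφ hm.symm).exists_toL2_eq (NeZero.ne N)
  exact ⟨m', by rw [← hm, synthesis_toL2 hφ]⟩

lemma IsMRAWith.eq_zero_of_eigenvector {v : H} (hv : v ∈ V 0) {c : ℂ} (hc : c ≠ 0)
    (hUv : (ρ.U : H →L[ℂ] H) v = c • v) : v = 0 := by
  have hneg : ∀ n : ℕ, v ∈ V (-n) := fun n => by
    induction n with
    | zero => simpa using hv
    | succ n ih =>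
      have h := hV.U_mem ih
      rw [hUv, Submodule.smul_mem_iff _ hc] at h
      convert h using 2; push_cast; ring
  have h : v ∈ ⨅ n, V n := by
    refine Submodule.mem_iInf _ |>.2 fun n => ?_
    exact hV.monotone (by omega) (hneg n.natAbs)
  rwa [hV.iInf_eq_bot, Submodule.mem_bot] at h

/-- If `m(z) ξ(z ^ N) = c ξ(z)`, then `π(ξ) φ` is an eigenvector of `U` in `V 0`. -/
lemma IsMRAWith.not_isDegenerate (hφ : ∀ f : Linf, inner ℂ φ (ρ.π f φ) = ∫ z, f z ∂haar)
    {m : Linf} (hm : (ρ.U : H →L[ℂ] H) φ = ρ.π m φ) : ¬ IsDegenerate N m := by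
  rintro ⟨-, ξ, c, hξ, h⟩
  have hcoe : Continuous (fun z : Circle => (z : ℂ)) := by fun_prop
  have hmem : MemLp (fun z => (ξ z : ℂ)) ∞ haar :=
    memLp_top_of_bound (hcoe.measurable.comp hξ).aestronglyMeasurable 1
      (Eventually.of_forall fun z => (Circle.norm_coe _).le)
  let g : Linf := hmem.toLp _
  have hg : g =ᵐ[haar] fun z => (ξ z : ℂ) := hmem.coeFn_toLp
  have hgm : Linf.mul (dilate N g) m = (c : ℂ) • g := by
    refine Lp.ext ?_
    filter_upwards [Linf.coeFn_mul (dilate N g) m, coeFn_dilate N g, ae_comp_pow N hg, hg,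
      Lp.coeFn_smul (c : ℂ) g, h] with z h1 h2 h3 h4 h5 h6
    rw [h1, h2, h3, h5, Pi.smul_apply, h4, smul_eq_mul, ← h6, mul_comm]
  have hgg : Linf.mul (star g) g = Linf.one := by
    refine Lp.ext ?_
    filter_upwards [Linf.coeFn_mul (star g) g, Lp.coeFn_star g, hg, Linf.coeFn_one]
      with z h1 h2 h3 h4
    rw [h1, h2, h4, Pi.star_apply, h3]
    simp [← Complex.normSq_eq_conj_mul_self]
  have hUv : (ρ.U : H →L[ℂ] H) (ρ.π g φ) = (c : ℂ) • ρ.π g φ := by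
    rw [U_π_apply, hm, ← π_mul_apply, hgm, map_smul, smul_apply]
  have hv : ρ.π g φ = 0 := by
    refine hV.eq_zero_of_eigenvector ?_ (Circle.coe_ne_zero c) hUv
    rw [hV.zero_eq, mem_translateSpan hφ]
    exact ⟨toL2 g, synthesis_toL2 hφ g⟩
  have hφ0 : φ = 0 := by
    rw [← ρ.π_one_apply φ, ← hgg, π_mul_apply, hv, map_zero]
  have h1 := hV.orthonormal.1 0
  simp only [hφ0, map_zero, norm_zero] at h1
  exact zero_ne_one h1

/-- An operator commuting with the representation and fixing `φ` fixes every `V n`. -/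
lemma IsMRAWith.eq_one_of_mem_commutant {p : H →L[ℂ] H} (hp : p ∈ ρ.commutant) (hpφ : p φ = φ) :
    p = 1 := by
  have hU : ∀ x, (ρ.U : H →L[ℂ] H) (p x) = p ((ρ.U : H →L[ℂ] H) x) := fun x =>
    congrArg (fun A : H →L[ℂ] H => A x) (hp _ (Or.inl rfl))
  have hπ : ∀ f x, ρ.π f (p x) = p (ρ.π f x) := fun f x =>
    congrArg (fun A : H →L[ℂ] H => A x) (hp _ (Or.inr ⟨f, rfl⟩))
  have hclosed : IsClosed {x | p x = x} := isClosed_eq p.continuous continuous_id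
  have h0 : ∀ x ∈ V 0, p x = x := fun x hx => by
    rw [hV.zero_eq] at hx
    have hle : ρ.translateSpan φ ≤ LinearMap.eqLocus p.toLinearMap LinearMap.id := by
      refine Submodule.topologicalClosure_minimal _ (Submodule.span_le.2 ?_) hclosed
      rintro - ⟨k, rfl⟩
      change p _ = _
      simp only [← π_monomial]
      rw [← hπ, hpφ]; rfl
    exact hle hx
  have hall : ∀ n : ℤ, ∀ x ∈ V n, p x = x := fun n => by
    induction n using Int.induction_on with
    | zero => exact h0
    | succ n ih =>
      intro x hx
      have h := ih _ (by simpa using hV.U_mem hx)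
      rw [← hU] at h
      rw [← ρ.U_inv_apply_U (p x), h, U_inv_apply_U]
    | pred n ih =>
      intro x hx
      rw [← hV.map_U] at hx
      obtain ⟨y, hy, rfl⟩ := hx
      change p ((ρ.U : H →L[ℂ] H) y) = (ρ.U : H →L[ℂ] H) y
      rw [← hU, ih y hy]
  have huniv : Set.univ ⊆ {x | p x = x} := by
    rw [← hV.closure_iUnion]
    exact closure_minimal (Set.iUnion_subset fun n x hx => hall n x hx) hclosed
  ext x
  exact huniv (Set.mem_univ x)

end OfMRA

/-! ### From the three conditions to a multiresolution analysis -/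

section ToMRA

lemma U_zpow_add (m n : ℤ) (x : H) :
    ((ρ.U ^ (m + n) : unitary (H →L[ℂ] H)) : H →L[ℂ] H) x =
      ((ρ.U ^ m : unitary (H →L[ℂ] H)) : H →L[ℂ] H)
        (((ρ.U ^ n : unitary (H →L[ℂ] H)) : H →L[ℂ] H) x) := by
  rw [zpow_add]; rfl

variable (ρ φ) in
/-- The scale of subspaces generated by `φ`: the space of index `n` consists of the vectors that
`U ^ n` maps into the closed span of the translates of `φ`. -/
def scale (n : ℤ) : Submodule ℂ H :=
  (ρ.translateSpan φ).comap
    (((ρ.U ^ n : unitary (H →L[ℂ] H)) : H →L[ℂ] H) : H →ₗ[ℂ] H)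

lemma mem_scale {n : ℤ} {x : H} : x ∈ ρ.scale φ n ↔
    ((ρ.U ^ n : unitary (H →L[ℂ] H)) : H →L[ℂ] H) x ∈ ρ.translateSpan φ := Iff.rfl

lemma scale_zero : ρ.scale φ 0 = ρ.translateSpan φ := by
  ext x; rw [mem_scale, zpow_zero]; rfl

lemma isClosed_scale (n : ℤ) : IsClosed (ρ.scale φ n : Set H) :=
  (Submodule.isClosed_topologicalClosure _).preimage
    ((ρ.U ^ n : unitary (H →L[ℂ] H)) : H →L[ℂ] H).continuous

lemma U_mem_scale_iff {n : ℤ} {x : H} :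
    (ρ.U : H →L[ℂ] H) x ∈ ρ.scale φ n ↔ x ∈ ρ.scale φ (n + 1) := by
  rw [mem_scale, mem_scale, U_zpow_add, zpow_one]

lemma map_U_scale (n : ℤ) :
    (ρ.scale φ n).map ((ρ.U : H →L[ℂ] H) : H →ₗ[ℂ] H) = ρ.scale φ (n - 1) := by
  ext x
  constructor
  · rintro ⟨y, hy, rfl⟩
    exact U_mem_scale_iff.2 (by rwa [sub_add_cancel])
  · intro hx
    refine ⟨((ρ.U⁻¹ : unitary (H →L[ℂ] H)) : H →L[ℂ] H) x, ?_, ρ.U_apply_U_inv x⟩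
    rw [← ρ.U_apply_U_inv x, U_mem_scale_iff, sub_add_cancel] at hx
    exact hx

/-- The orthogonal projection onto a subspace that reduces `A` commutes with `A`. -/
lemma commute_starProjection {K : Submodule ℂ H} [K.HasOrthogonalProjection] {A : H →L[ℂ] H}
    (hA : ∀ x ∈ K, A x ∈ K) (hA' : ∀ x ∈ K, star A x ∈ K) :
    A * K.starProjection = K.starProjection * A := by
  ext x
  rw [mul_apply_eq_comp, mul_apply_eq_comp]
  refine (Submodule.eq_starProjection_of_mem_orthogonal
    (hA _ (K.starProjection_apply_mem x)) ?_).symm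
  rw [← map_sub, Submodule.mem_orthogonal]
  intro u hu
  rw [← ContinuousLinearMap.adjoint_inner_left, ← ContinuousLinearMap.star_eq_adjoint]
  exact Submodule.sub_starProjection_mem_orthogonal (K := K) x _ (hA' u hu)

variable (hφ : ∀ f : Linf, inner ℂ φ (ρ.π f φ) = ∫ z, f z ∂haar) {m : Linf}
  (hm : (ρ.U : H →L[ℂ] H) φ = ρ.π m φ)

include hφ

lemma π_mem_translateSpan (f : Linf) {x : H} (hx : x ∈ ρ.translateSpan φ) :
    ρ.π f x ∈ ρ.translateSpan φ := by
  obtain ⟨g, rfl⟩ := (mem_translateSpan hφ).1 hx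
  exact (mem_translateSpan hφ).2 ⟨mulL2 f g, (π_synthesis hφ f g).symm⟩

/-- `U ^ n π(f) = π(f(z ^ (N ^ n))) U ^ n` for `n ≥ 0`, so the spaces of nonnegative index are
invariant under `π`. -/
lemma π_mem_scale (n : ℕ) (f : Linf) {x : H} (hx : x ∈ ρ.scale φ n) :
    ρ.π f x ∈ ρ.scale φ n := by
  induction n generalizing x f with
  | zero =>
    rw [Nat.cast_zero, scale_zero] at hx ⊢
    exact π_mem_translateSpan hφ f hx
  | succ n ih =>
    rw [Nat.cast_succ, ← U_mem_scale_iff] at hx ⊢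
    rw [U_π_apply]
    exact ih _ hx

include hm

lemma monotone_scale : Monotone (ρ.scale φ) := by
  refine monotone_int_of_le_succ fun n x hx => ?_
  obtain ⟨f, hf⟩ := (mem_translateSpan hφ).1 (mem_scale.1 hx)
  rw [mem_scale, add_comm, U_zpow_add, zpow_one, ← hf, U_synthesis hφ hm]
  exact (mem_translateSpan hφ).2 ⟨_, rfl⟩

/-- A nonzero vector in the intersection of the scale would give, through `U⁻ⁿ`, a backward orbit
of `f ↦ m(z) f(z ^ N)` in `L²`. -/
lemma iInf_scale_eq_bot (hdeg : ¬ IsDegenerate N m) : ⨅ n, ρ.scale φ n = ⊥ := by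
  by_contra hne
  obtain ⟨v, hv, hv0⟩ := Submodule.exists_mem_ne_zero_of_ne_bot hne
  set u : H := ((‖v‖⁻¹ : ℝ) : ℂ) • v with hu
  have hu1 : ‖u‖ = 1 := by
    rw [hu, norm_smul, Complex.norm_real, Real.norm_of_nonneg (by positivity),
      inv_mul_cancel₀ (norm_ne_zero_iff.2 hv0)]
  have humem : ∀ n : ℕ, ∃ f : L2, ρ.synthesis φ f =
      ((ρ.U ^ (-(n : ℤ)) : unitary (H →L[ℂ] H)) : H →L[ℂ] H) u := fun n => by
    rw [← mem_translateSpan hφ, ← mem_scale]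
    exact Submodule.smul_mem _ _ ((Submodule.mem_iInf _).1 hv _)
  choose f hf using humem
  have hstep : ∀ n, ρ.synthesis φ (f n) = (ρ.U : H →L[ℂ] H) (ρ.synthesis φ (f (n + 1))) :=
    fun n => by
      have h : (-(n : ℤ)) = 1 + -((n + 1 : ℕ) : ℤ) := by push_cast; ring
      rw [hf, hf, h, U_zpow_add, zpow_one]
  have hnorm : ∀ n, ‖f n‖ = 1 := fun n => by
    induction n with
    | zero =>
      rw [← norm_synthesis hφ, hf, Nat.cast_zero, neg_zero, zpow_zero]; exact hu1
    | succ n ih =>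
      rw [← norm_synthesis hφ, ← ρ.norm_U, ← hstep, norm_synthesis hφ, ih]
  have hrec : ∀ n, f n =ᵐ[haar] fun z => m z * f (n + 1) (z ^ N) := fun n => by
    have h := hstep n
    rw [U_synthesis hφ hm] at h
    have h2 := synthesis_injective hφ h
    rw [h2]
    filter_upwards [coeFn_mulL2 m (dilateL2 N (f (n + 1))), coeFn_dilateL2 N (f (n + 1))]
      with z h3 h4
    rw [h3, h4]
  have hquad : IsQuadrature N (toL2 m) :=
    isQuadrature_of_U_eq hφ (by rw [hm, synthesis_toL2 hφ])
  have hN : 2 ≤ N := Nat.AtLeastTwo.prop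
  refine hdeg (isDegenerate_of_backwardOrbit hN (fun q hq => ?_) hrec hnorm)
  rw [← hquad.integral (measurable_coeFn _) hq]
  refine integral_congr_ae ?_
  filter_upwards [coeFn_toL2 m] with z hz
  rw [hz]

/-- The closure of the union of the scale reduces the representation and contains `φ`. -/
lemma closure_iUnion_scale
    (hcyc : ¬ ∃ p : H →L[ℂ] H, IsStarProjection p ∧ p ∈ ρ.commutant ∧ p ≠ 1 ∧ p φ = φ) :
    closure (⋃ n, (ρ.scale φ n : Set H)) = Set.univ := by
  have hmono := monotone_scale hφ hm
  set W : Submodule ℂ H := ⨆ n, ρ.scale φ n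
  have hW : ∀ x, x ∈ W ↔ ∃ n, x ∈ ρ.scale φ n := fun x =>
    Submodule.mem_iSup_of_directed _ hmono.directed_le
  have hWset : (W : Set H) = ⋃ n, (ρ.scale φ n : Set H) :=
    Submodule.coe_iSup_of_directed _ hmono.directed_le
  set K : Submodule ℂ H := W.topologicalClosure with hK
  have hKc : IsClosed (K : Set H) := W.isClosed_topologicalClosure
  have : CompleteSpace K := hKc.completeSpace_coe
  have hext : ∀ A : H →L[ℂ] H, (∀ x ∈ W, A x ∈ W) → ∀ x ∈ K, A x ∈ K := fun A hA x hx =>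
    map_mem_closure A.continuous hx hA
  have hUW : ∀ x ∈ W, (ρ.U : H →L[ℂ] H) x ∈ W := fun x hx => by
    obtain ⟨n, hn⟩ := (hW x).1 hx
    exact (hW _).2 ⟨n - 1, U_mem_scale_iff.2 (by rwa [sub_add_cancel])⟩
  have hUW' : ∀ x ∈ W, star (ρ.U : H →L[ℂ] H) x ∈ W := fun x hx => by
    obtain ⟨n, hn⟩ := (hW x).1 hx
    refine (hW _).2 ⟨n + 1, U_mem_scale_iff.1 ?_⟩
    change (ρ.U : H →L[ℂ] H) (((ρ.U⁻¹ : unitary (H →L[ℂ] H)) : H →L[ℂ] H) x) ∈ _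
    rwa [U_apply_U_inv]
  have hπW : ∀ f : Linf, ∀ x ∈ W, ρ.π f x ∈ W := fun f x hx => by
    obtain ⟨n, hn⟩ := (hW x).1 hx
    exact (hW _).2 ⟨n.natAbs, π_mem_scale hφ n.natAbs f (hmono (by omega) hn)⟩
  have hφK : φ ∈ K := by
    refine W.le_topologicalClosure ((hW φ).2 ⟨0, ?_⟩)
    rw [scale_zero]
    exact (mem_translateSpan hφ).2 ⟨toL2 Linf.one, by rw [synthesis_toL2 hφ, π_one_apply]⟩
  have hp1 : K.starProjection = 1 := by
    by_contra hne
    refine hcyc ⟨K.starProjection, isStarProjection_starProjection, ?_, hne,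
      Submodule.starProjection_eq_self_iff.2 hφK⟩
    rintro A (rfl | ⟨f, rfl⟩)
    · exact commute_starProjection (hext _ hUW) (hext _ hUW')
    · refine commute_starProjection (hext _ (hπW f)) (hext _ ?_)
      rw [← ρ.map_star]
      exact hπW (star f)
  rw [← hWset, ← Submodule.topologicalClosure_coe, ← hK, Set.eq_univ_iff_forall]
  intro x
  exact Submodule.starProjection_eq_self_iff.1 (by rw [hp1]; rfl)

end ToMRA

end WaveletRep

end Wavelet

end

theorem theorem2p8 (N : ℕ) [N.AtLeastTwo] {H : Type*} [NormedAddCommGroup H]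
    [InnerProductSpace ℂ H] [CompleteSpace H] (ρ : Wavelet.WaveletRep N H) (hρ : ρ.IsNormal)
    (φ : H) :
    ρ.IsOrthogonalScalingVector φ ↔
      (∃ h : Circle → ℂ, ρ.IsCorrelationFunction φ φ h ∧ ∀ᵐ z ∂Wavelet.haar, h z = 1) ∧
      (∃ m₀ : Wavelet.Linf, ¬ Wavelet.IsDegenerate N m₀ ∧
        (ρ.U : H →L[ℂ] H) φ = ρ.π m₀ φ) ∧
      ¬ ∃ p : H →L[ℂ] H, IsStarProjection p ∧ p ∈ ρ.commutant ∧ p ≠ 1 ∧ p φ = φ := by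
  rw [Wavelet.WaveletRep.exists_correlation_eq_one_iff]
  constructor
  · rintro ⟨V, hV⟩
    have hφ := Wavelet.WaveletRep.inner_π_of_orthonormal hρ hV.orthonormal
    obtain ⟨m, hm⟩ := hV.exists_U_eq hφ
    exact ⟨hφ, ⟨m, hV.not_isDegenerate hφ hm, hm⟩, fun ⟨_, _, hp, hp1, hpφ⟩ =>
      hp1 (hV.eq_one_of_mem_commutant hp hpφ)⟩
  · rintro ⟨hφ, ⟨m, hdeg, hm⟩, hcyc⟩
    refine ⟨ρ.scale φ, ?_⟩
    exact
      { isClosed := Wavelet.WaveletRep.isClosed_scale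
        le_succ := fun n => Wavelet.WaveletRep.monotone_scale hφ hm (by omega)
        closure_iUnion := Wavelet.WaveletRep.closure_iUnion_scale hφ hm hcyc
        iInf_eq_bot := Wavelet.WaveletRep.iInf_scale_eq_bot hφ hm hdeg
        map_U := Wavelet.WaveletRep.map_U_scale
        mem_zero := by
          rw [Wavelet.WaveletRep.scale_zero]
          refine Submodule.le_topologicalClosure _ (Submodule.subset_span ⟨0, ?_⟩)
          simp
        orthonormal := Wavelet.WaveletRep.orthonormal_translates hφ
        closure_span := Wavelet.WaveletRep.scale_zero.symm }
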